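/- **Conventions.** Let $T$ be a first-order theory and let $\lambda$ be an infinite limit ordinal (for instance an infinite cardinal). Write ${}^{\lambda>}2$ for the tree of $0$-$1$ sequences of length $<\lambda$, $\eta\lhd\nu$ for "$\eta$ is a proper initial segment of $\nu$", and $\eta\perp\nu$ for "neither of $\eta,\nu$ is an initial segment of the other". Write ${}^{n}m$ and ${}^{n\ge}m$ for the sets of sequences of length $n$, respectively of length at most $n$, with entries in $\{0,\dots,m-1\}$. Formulas $\vartheta(\bar x;\bar y)$ have finite tuples of variables. For tuples $\bar b$ from a model $M$ of $T$, a set of formulas $\vartheta(\bar x;\bar b)$ is *consistent* if each of its finite subsets is realized in $M$ (equivalently, the whole set is realized in some elementary extension of $M$), and *inconsistent* otherwise. * $\vartheta(\bar x;\bar y)$ *exemplifies SOP$_2$ in $T$* if in some model of $T$ (for complete $T$, equivalently, in a monster model of $T$) there are tuples $\bar a_\eta$, $\eta\in{}^{\omega>}2$, such that (a) for every $\eta\in{}^{\omega}2$ the set $\{\vartheta(\bar x;\bar a_{\eta\restriction \ell}):\ell<\omega\}$ is consistent, and (b) whenever $\eta,\nu\in{}^{\omega>}2$ and $\eta\perp\nu$,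 the set $\{\vartheta(\bar x;\bar a_\eta),\vartheta(\bar x;\bar a_\nu)\}$ is inconsistent. * $\vartheta(\bar x;\bar y)$ *exemplifies SOP$''_2$ in $T$ (with tree height $\lambda$)* if for some $n<\omega$, in some model of $T$ (for complete $T$, equivalently, in a sufficiently saturated monster model of $T$), there are tuples $\bar a_{\bar\eta}$, indexed by the chains $\bar\eta=\langle\eta_0\lhd\eta_1\lhd\dots\lhd\eta_n\rangle$ of elements of ${}^{\lambda>}2$ of successor length, such that (a) for every $\eta\in{}^{\lambda}2$ the set of all $\vartheta(\bar x;\bar a_{\bar\eta})$ with $\bar\eta=\langle\eta\restriction(\alpha_0+1),\dots,\eta\restriction(\alpha_n+1)\rangle$ and $\alpha_0<\dots<\alpha_n<\lambda$ is consistent, and (b) for every large enough $m<\omega$, whenever $h$ is a one-to-one map from ${}^{n\ge}m$ to the set of elements of ${}^{\lambda>}2$ of successor length that preserves $\lhd$ and $\perp$, the set $\{\vartheta(\bar x;\bar a_{\langle h(\eta\restriction \ell):\ell\le n\rangle}):\eta\in{}^{n}m\}$ is inconsistent. * $T$ *has* SOP$_2$ (respectively SOP$''_2$ with tree height $\lambda$)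 if some formula exemplifies it in $T$. **Theorem.** Let $T$ be a first-order theory and let $\lambda$ be an infinite limit ordinal. 1. If $\vartheta(\bar x;\bar y)$ exemplifies SOP$_2$ in $T$, then $\vartheta(\bar x;\bar y)$ exemplifies SOP$''_2$ in $T$ with tree height $\lambda$. 2. If $\vartheta(\bar x;\bar y)$ exemplifies SOP$''_2$ in $T$ with tree height $\lambda$, then for some $k<\omega$ the formula $\vartheta^{\langle k\rangle}(\bar x;\bar y_0,\dots,\bar y_{k-1})=\bigwedge_{\ell<k}\vartheta(\bar x;\bar y_\ell)$ exemplifies SOP$_2$ in $T$. Consequently, $T$ has SOP$_2$ if and only if $T$ has SOP$''_2$ with tree height $\lambda$. -/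

import Mathlib

universe u v w

namespace OrderTree

/-- A node of the binary tree `^{lam>}2`: a `0-1` sequence whose length is an ordinal below `lam`.
Here the ordinal `lam` is presented as a well-ordered type `I` (the set of ordinals below `lam`), so
that an element `len : I` is an ordinal below `lam` and the elements of `I` below `len` are the
ordinals below `len`. For `I = ℕ` these are the finite `0-1` sequences, `^{ω>}2`. -/
structure BinNode (I : Type w) [LinearOrder I] where
  len : I
  val : Set.Iio len → Bool

namespace BinNode

variable {I : Type w} [LinearOrder I]

/-- `η ⊴ ν`: the sequence `η` is an initial segment of the sequence `ν`. -/
def IsInitial (η ν : BinNode I) : Prop :=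
  ∃ h : η.len ≤ ν.len, ∀ i : Set.Iio η.len, ν.val ⟨i.1, lt_of_lt_of_le i.2 h⟩ = η.val i

/-- `η ◁ ν`: the sequence `η` is a proper initial segment of the sequence `ν`. -/
def IsProperInitial (η ν : BinNode I) : Prop :=
  η.IsInitial ν ∧ η ≠ ν

/-- `η ⊥ ν`: neither sequence is an initial segment of the other. -/
def Incomparable (η ν : BinNode I) : Prop :=
  ¬ η.IsInitial ν ∧ ¬ ν.IsInitial η

/-- The length of the node is a successor ordinal. -/
def HasSuccLength (η : BinNode I) : Prop :=
  ∃ α : I, α ⋖ η.len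

/-- The restriction `η ↾ α` of a branch `η ∈ ^lam 2` to an ordinal `α < lam`. -/
def restrict (η : I → Bool) (α : I) : BinNode I :=
  ⟨α, fun i => η i.1⟩

end BinNode

/-- `^{n≥}m`: the sequences of length at most `n` with entries in `{0, …, m - 1}`. -/
abbrev FinNode (m n : ℕ) : Type :=
  {s : List (Fin m) // s.length ≤ n}

/-- The restriction `s ↾ l` of a sequence in `^{n≥}m`. -/
def FinNode.restrict {m n : ℕ} (s : FinNode m n) (l : ℕ) : FinNode m n :=
  ⟨s.1.take l, (List.length_take_le' l s.1).trans s.2⟩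

/-- A one-to-one map from `^{n≥}m` to the nodes of successor length in the binary tree of height
`lam`, preserving `◁` and `⊥`. -/
structure IsTreeEmbedding {I : Type w} [LinearOrder I] {m n : ℕ}
    (h : FinNode m n → BinNode I) : Prop where
  injective : Function.Injective h
  map_properInitial : ∀ s t : FinNode m n, s.1 <+: t.1 → s ≠ t → (h s).IsProperInitial (h t)
  map_incomparable : ∀ s t : FinNode m n, ¬ s.1 <+: t.1 → ¬ t.1 <+: s.1 →
    (h s).Incomparable (h t)
  hasSuccLength : ∀ s : FinNode m n, (h s).HasSuccLength

section Formulas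

variable {L : FirstOrder.Language.{u, v}} {α β : Type}

/-- The set of formulas `{φ(x, b) : b ∈ B}` with parameters in `M` is consistent, that is, each of
its finite subsets is realized in `M` (equivalently, all of it is realized in some elementary
extension of `M`). -/
def Consistent {M : Type*} [L.Structure M] (φ : L.Formula (α ⊕ β)) (B : Set (β → M)) : Prop :=
  ∀ F : Finset (β → M), (F : Set (β → M)) ⊆ B →
    ∃ x : α → M, ∀ b ∈ F, φ.Realize (Sum.elim x b)

/-- `φ(x; y)` exemplifies `SOP_2` in `T`. The parameters are taken from some model of `T`; for
complete `T` this is the same as taking them from a monster model of `T`. -/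
def ExemplifiesSOPTwo (T : L.Theory) (φ : L.Formula (α ⊕ β)) : Prop :=
  ∃ (M : T.ModelType.{u, v, max u v}) (a : BinNode ℕ → β → M),
    (∀ η : ℕ → Bool, Consistent φ (Set.range fun l : ℕ => a (BinNode.restrict η l))) ∧
    (∀ η ν : BinNode ℕ, η.Incomparable ν → ¬ Consistent φ {a η, a ν})

/-- `φ(x; y)` exemplifies `SOP''_2` in `T`, with the binary tree of height `lam`, where `lam` is the
order type of `I`. The family `a` is indexed by the chains `η_0 ◁ ⋯ ◁ η_n` of nodes of successor
length; its values at other tuples are not used. -/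
def ExemplifiesSOPTwoPrimePrime (T : L.Theory) (I : Type w) [LinearOrder I]
    (φ : L.Formula (α ⊕ β)) : Prop :=
  ∃ (M : T.ModelType.{u, v, max u v w}) (n : ℕ) (a : (Fin (n + 1) → BinNode I) → β → M),
    (∀ η : I → Bool, Consistent φ
      {b | ∃ c : Fin (n + 1) → I, StrictMono c ∧
        (∀ l, (BinNode.restrict η (c l)).HasSuccLength) ∧
        b = a (fun l => BinNode.restrict η (c l))}) ∧
    (∃ m₀ : ℕ, ∀ m ≥ m₀, ∀ h : FinNode m n → BinNode I, IsTreeEmbedding h →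
      ¬ Consistent φ
        {b | ∃ s : FinNode m n, s.1.length = n ∧
          b = a (fun l : Fin (n + 1) => h (s.restrict l))})

/-- `T` has `SOP_2`. -/
def HasSOPTwo (T : L.Theory) : Prop :=
  ∃ (p q : ℕ) (φ : L.Formula (Fin p ⊕ Fin q)), ExemplifiesSOPTwo T φ

/-- `T` has `SOP''_2`, with the binary tree whose height is the order type of `I`. -/
def HasSOPTwoPrimePrime (T : L.Theory) (I : Type w) [LinearOrder I] : Prop :=
  ∃ (p q : ℕ) (φ : L.Formula (Fin p ⊕ Fin q)), ExemplifiesSOPTwoPrimePrime T I φ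

/-- The formula `φ^{<k>}(x; y_0, …, y_{k-1})`, the conjunction of the `φ(x; y_l)` for `l < k`. -/
noncomputable def conjPower (φ : L.Formula (α ⊕ β)) (k : ℕ) : L.Formula (α ⊕ (Fin k × β)) :=
  FirstOrder.Language.Formula.iInf fun l : Fin k => φ.relabel (Sum.map id fun j : β => (l, j))

theorem realize_conjPower {M : Type*} [L.Structure M] (φ : L.Formula (α ⊕ β)) (k : ℕ)
    (x : α → M) (b : Fin k × β → M) :
    (conjPower φ k).Realize (Sum.elim x b) ↔
      ∀ l : Fin k, φ.Realize (Sum.elim x fun j => b (l, j)) := by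
  simp only [conjPower, FirstOrder.Language.Formula.realize_iInf,
    FirstOrder.Language.Formula.realize_relabel]
  refine forall_congr' fun l => ?_
  rw [Sum.elim_comp_map]
  rfl

end Formulas

end OrderTree

-- From SOP$_2$ to SOP$''_2$: take `n = 1` and let a chain use only the parameter of its top node. A
-- finite part of a taller binary tree collapses into ${}^{\omega>}2$, keeping order and
-- incomparability (`BinNode.exists_collapse`), and compactness does the rest.
--
-- For the converse, call a finite list of nodes consistent if the instances of the formula at all
-- increasing `(n + 1)`-tuples from it have a common solution (`ConOn`). By (a), chains of successor
-- nodes are consistent. A configuration is a fixed list `u` together with finitely many tall trees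
-- such that `u` plus one chain from each tree is always consistent (`Compat`). Either every
-- configuration of tall enough trees lets its first tree be split into two incomparable ones after
-- shrinking (`Splittable`), or not.
--
-- If splitting is always possible, repeated splitting grows a copy of ${}^{n\ge}m$ inside a single
-- consistent list (`Splittable.extendableBy_hasBlob`), contradicting (b).
--
-- Otherwise, for some fixed numbers `s`, `E`, `h`, there are arbitrarily tall configurations that
-- cannot be split. By a polarized Ramsey theorem for chains (`polarized_ramsey`), two incomparable
-- subtrees can be shrunk until all choices of chains of length `h` are consistent, or none is; the
-- former would give a splitting. Hence there are arbitrarily high binary trees of chains of bounded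
-- length in which incomparable chains are inconsistent over a list of bounded length
-- (`exists_chainTree_of_not_splittable`). The instances at the tuples from that list and one chain
-- form one instance of a fixed power of the formula, and compactness yields SOP$_2$.

universe w'

namespace OrderTree

/-! ### Copies of finite binary trees in a partial order, and their chains. -/

section Combinatorics

variable {P : Type*} [PartialOrder P]

/-- Neither of the two elements is below the other. -/
def Incomp (a b : P) : Prop := ¬ a ≤ b ∧ ¬ b ≤ a

theorem Incomp.symm {a b : P} (h : Incomp a b) : Incomp b a := ⟨h.2, h.1⟩

/-- The set `S` contains a copy of the complete binary tree with `t` levels. -/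
def Tall : ℕ → Set P → Prop
  | 0, _ => True
  | t + 1, S => ∃ r ∈ S, ∃ A ⊆ S, ∃ B ⊆ S, (∀ a ∈ A, r < a) ∧ (∀ b ∈ B, r < b) ∧
      (∀ a ∈ A, ∀ b ∈ B, Incomp a b) ∧ Tall t A ∧ Tall t B

theorem Tall.mono {t : ℕ} {S S' : Set P} (h : Tall t S) (hS : S ⊆ S') : Tall t S' := by
  cases t with
  | zero => trivial
  | succ t =>
    obtain ⟨r, hr, A, hA, B, hB, h⟩ := h
    exact ⟨r, hS hr, A, hA.trans hS, B, hB.trans hS, h⟩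

theorem Tall.of_succ {t : ℕ} {S : Set P} (h : Tall (t + 1) S) : Tall t S := by
  obtain ⟨r, -, A, hA, B, hB, -, -, -, h, -⟩ := h
  exact h.mono hA

theorem Tall.of_le {t t' : ℕ} (htt : t ≤ t') {S : Set P} (h : Tall t' S) : Tall t S := by
  induction t', htt using Nat.le_induction with
  | base => exact h
  | succ k _ ih => exact ih h.of_succ

/-- Pigeonhole by induction: a root in `R` either tops two copies in `R` that are one level lower,
or one of the two subtrees already has the required copy in `B`. A root in `B` is treated
symmetrically. -/
theorem Tall.of_cover {k : ℕ} : ∀ {a b : ℕ}, a + b = k → ∀ {S R B : Set P}, Tall k S →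
    S ⊆ R ∪ B → Tall a (S ∩ R) ∨ Tall b (S ∩ B) := by
  induction k with
  | zero =>
    intro a b hab S R B _ _
    obtain rfl : a = 0 := by omega
    exact Or.inl trivial
  | succ k ih =>
    intro a b hab S R B hS hc
    rcases a with _ | a
    · exact Or.inl trivial
    rcases b with _ | b
    · exact Or.inr trivial
    obtain ⟨r, hr, X, hX, Y, hY, hrX, hrY, hXY, hTX, hTY⟩ := hS
    rcases hc hr with hrR | hrB
    · rcases ih (a := a) (b := b + 1) (by omega) hTX (hX.trans hc) with h1 | h1
      · rcases ih (a := a) (b := b + 1) (by omega) hTY (hY.trans hc) with h2 | h2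
        · exact Or.inl ⟨r, ⟨hr, hrR⟩, _, Set.inter_subset_inter_left _ hX, _,
            Set.inter_subset_inter_left _ hY, fun x hx => hrX x hx.1, fun x hx => hrY x hx.1,
            fun x hx y hy => hXY x hx.1 y hy.1, h1, h2⟩
        · exact Or.inr (h2.mono (Set.inter_subset_inter_left _ hY))
      · exact Or.inr (h1.mono (Set.inter_subset_inter_left _ hX))
    · rcases ih (a := a + 1) (b := b) (by omega) hTX (hX.trans hc) with h1 | h1
      · exact Or.inl (h1.mono (Set.inter_subset_inter_left _ hX))
      · rcases ih (a := a + 1) (b := b) (by omega) hTY (hY.trans hc) with h2 | h2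
        · exact Or.inl (h2.mono (Set.inter_subset_inter_left _ hY))
        · exact Or.inr ⟨r, ⟨hr, hrB⟩, _, Set.inter_subset_inter_left _ hX, _,
            Set.inter_subset_inter_left _ hY, fun x hx => hrX x hx.1, fun x hx => hrY x hx.1,
            fun x hx y hy => hXY x hx.1 y hy.1, h1, h2⟩

/-- The list `l` is a strictly increasing sequence of elements of `S`. -/
structure ChainIn (S : Set P) (l : List P) : Prop where
  pairwise : l.Pairwise (· < ·)
  mem : ∀ x ∈ l, x ∈ S

theorem ChainIn.mono {S S' : Set P} {l : List P} (h : ChainIn S l) (hS : S ⊆ S') :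
    ChainIn S' l := ⟨h.pairwise, fun x hx => hS (h.mem x hx)⟩

theorem ChainIn.tail {S : Set P} {x : P} {l : List P} (h : ChainIn S (x :: l)) : ChainIn S l :=
  ⟨(List.pairwise_cons.1 h.pairwise).2, fun y hy => h.mem y (List.mem_cons_of_mem _ hy)⟩

theorem chainIn_nil (S : Set P) : ChainIn S [] := ⟨List.Pairwise.nil, by simp⟩

theorem ChainIn.cons {S : Set P} {x : P} {l : List P} (h : ChainIn S l) (hx : x ∈ S)
    (hl : ∀ y ∈ l, x < y) : ChainIn S (x :: l) :=
  ⟨List.pairwise_cons.2 ⟨hl, h.pairwise⟩, by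
    intro y hy
    rcases List.mem_cons.1 hy with rfl | hy
    exacts [hx, h.mem y hy]⟩

/-- In the union of a root and two incomparable sets above it, the elements of a chain above a given
element of one of the sets stay in that set. -/
theorem mem_of_lt_of_mem {r x y : P} {A B : Set P} (hA : ∀ a ∈ A, r < a)
    (hAB : ∀ a ∈ A, ∀ b ∈ B, Incomp a b) (hx : x ∈ A) (hxy : x < y)
    (hy : y ∈ insert r (A ∪ B)) : y ∈ A := by
  rcases hy with rfl | hy | hy
  · exact absurd (hA x hx) hxy.asymm
  · exact hy
  · exact absurd hxy.le (hAB x hx y hy).1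

theorem ChainIn.of_head_mem {r x : P} {l : List P} {A B : Set P} (hA : ∀ a ∈ A, r < a)
    (hAB : ∀ a ∈ A, ∀ b ∈ B, Incomp a b) (hx : x ∈ A)
    (h : ChainIn (insert r (A ∪ B)) (x :: l)) : ChainIn A (x :: l) := by
  refine ⟨h.pairwise, fun y hy => ?_⟩
  rcases List.mem_cons.1 hy with rfl | hy'
  · exact hx
  · exact mem_of_lt_of_mem hA hAB hx ((List.pairwise_cons.1 h.pairwise).1 y hy') (h.mem y hy)

/-! ### Ramsey's theorem for chains in a tree. -/

/-- End-homogeneous subtrees exist when homogeneous subtrees for shorter chains do. -/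
theorem exists_end_homogeneous {h : ℕ}
    (ramsey : ∀ t, ∃ H, ∀ S : Set P, Tall H S → ∀ χ : List P → Prop, ∃ S' ⊆ S, Tall t S' ∧
      ((∀ l, ChainIn S' l → l.length = h → χ l) ∨ ∀ l, ChainIn S' l → l.length = h → ¬ χ l))
    (t : ℕ) : ∃ H, ∀ S : Set P, Tall H S → ∀ χ : List P → Prop, ∃ S' ⊆ S, Tall t S' ∧
      ∀ x l l', ChainIn S' (x :: l) → ChainIn S' (x :: l') → l.length = h → l'.length = h →
        (χ (x :: l) ↔ χ (x :: l')) := by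
  induction t with
  | zero =>
    exact ⟨0, fun S _ χ => ⟨∅, Set.empty_subset _, trivial, fun x l l' hl =>
      absurd (hl.mem x List.mem_cons_self) (Set.notMem_empty x)⟩⟩
  | succ t ih =>
    obtain ⟨H, hH⟩ := ih
    -- The extra level pays for the root `r'` of the homogeneous tree, which is thrown away: only
    -- the two incomparable trees above it are kept, to be placed above `r`.
    obtain ⟨K, hK⟩ := ramsey (H + 1)
    refine ⟨K + 1, fun S hS χ => ?_⟩
    obtain ⟨r, hr, A, hA, -, -, hrA, -, -, hTA, -⟩ := hS
    obtain ⟨A', hA', hTA', hhom⟩ := hK A hTA fun l => χ (r :: l)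
    obtain ⟨r', -, X, hX, Y, hY, -, -, hXY, hTX, hTY⟩ := hTA'
    obtain ⟨X', hX', hTX', hendX⟩ := hH X hTX χ
    obtain ⟨Y', hY', hTY', hendY⟩ := hH Y hTY χ
    have hXA : X' ⊆ A' := hX'.trans hX
    have hYA : Y' ⊆ A' := hY'.trans hY
    have hrX : ∀ x ∈ X', r < x := fun x hx => hrA x (hA' (hXA hx))
    have hrY : ∀ x ∈ Y', r < x := fun x hx => hrA x (hA' (hYA hx))
    have hXY' : ∀ x ∈ X', ∀ y ∈ Y', Incomp x y := fun x hx y hy => hXY x (hX' hx) y (hY' hy)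
    refine ⟨insert r (X' ∪ Y'), ?_, ⟨r, Set.mem_insert _ _, X', ?_, Y', ?_, hrX, hrY, hXY', hTX',
      hTY'⟩, ?_⟩
    · exact Set.insert_subset hr
        (Set.union_subset (hXA.trans (hA'.trans hA)) (hYA.trans (hA'.trans hA)))
    · exact fun x hx => Or.inr (Or.inl hx)
    · exact fun x hx => Or.inr (Or.inr hx)
    · intro x l l' hl hl' hlen hlen'
      rcases hl.mem x List.mem_cons_self with rfl | hx | hx
      · have aux : ∀ m, ChainIn (insert x (X' ∪ Y')) (x :: m) → ChainIn A' m := by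
          intro m hm
          refine ⟨hm.tail.pairwise, fun y hy => ?_⟩
          rcases hm.tail.mem y hy with rfl | hy' | hy'
          · exact absurd ((List.pairwise_cons.1 hm.pairwise).1 y hy) (lt_irrefl y)
          · exact hXA hy'
          · exact hYA hy'
        rcases hhom with hhom | hhom
        · exact iff_of_true (hhom l (aux l hl) hlen) (hhom l' (aux l' hl') hlen')
        · exact iff_of_false (hhom l (aux l hl) hlen) (hhom l' (aux l' hl') hlen')
      · exact hendX x l l' (hl.of_head_mem hrX hXY' hx) (hl'.of_head_mem hrX hXY' hx) hlen hlen'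
      · rw [Set.union_comm] at hl hl'
        have hYX : ∀ y ∈ Y', ∀ x ∈ X', Incomp y x := fun y hy x hx => (hXY' x hx y hy).symm
        exact hendY x l l' (hl.of_head_mem hrY hYX hx) (hl'.of_head_mem hrY hYX hx) hlen hlen'

/-- Ramsey's theorem for the chains of a fixed length in a binary tree. -/
theorem ramsey_chains (h : ℕ) : ∀ t, ∃ H, ∀ S : Set P, Tall H S → ∀ χ : List P → Prop,
    ∃ S' ⊆ S, Tall t S' ∧
      ((∀ l, ChainIn S' l → l.length = h → χ l) ∨
        ∀ l, ChainIn S' l → l.length = h → ¬ χ l) := by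
  induction h with
  | zero =>
    refine fun t => ⟨t, fun S hS χ => ⟨S, subset_rfl, hS, ?_⟩⟩
    by_cases hχ : χ []
    · exact Or.inl fun l _ hl => by rwa [List.length_eq_zero_iff.1 hl]
    · exact Or.inr fun l _ hl => by rwa [List.length_eq_zero_iff.1 hl]
  | succ h ih =>
    intro t
    obtain ⟨H, hH⟩ := exists_end_homogeneous ih (t + t)
    refine ⟨H, fun S hS χ => ?_⟩
    obtain ⟨S₁, hS₁, hT, hend⟩ := hH S hS χ
    -- By end-homogeneity the colour of a chain depends only on its least element, so a colouring of
    -- elements remains; a tree of height `t + t` has a monochromatic one of height `t`. An element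
    -- that starts no chain of the right length falls into `Dᶜ` harmlessly.
    let D : Set P := {x | ∃ l, ChainIn S₁ (x :: l) ∧ l.length = h ∧ χ (x :: l)}
    rcases hT.of_cover rfl (R := D) (B := Dᶜ) (by simp) with h1 | h1
    · refine ⟨S₁ ∩ D, Set.inter_subset_left.trans hS₁, h1, Or.inl ?_⟩
      rintro (_ | ⟨x, l⟩) hl hlen
      · simp at hlen
      · obtain ⟨l', hl', hlen', hχ⟩ := (hl.mem x List.mem_cons_self).2
        exact (hend x l l' (hl.mono Set.inter_subset_left) hl' (by simpa using hlen) hlen').2 hχ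
    · refine ⟨S₁ ∩ Dᶜ, Set.inter_subset_left.trans hS₁, h1, Or.inr ?_⟩
      rintro (_ | ⟨x, l⟩) hl hlen hχ
      · simp at hlen
      · exact (hl.mem x List.mem_cons_self).2
          ⟨l, hl.mono Set.inter_subset_left, by simpa using hlen, hχ⟩

/-- A set with a copy of the binary tree of height `h` contains such a copy in which every chain
extends to a chain of length `h`. -/
theorem Tall.exists_pure {h : ℕ} : ∀ {S : Set P}, Tall h S → ∃ S' ⊆ S, Tall h S' ∧
    ∀ l, ChainIn S' l → ∃ l', ChainIn S' l' ∧ l'.length = h ∧ l ⊆ l' := by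
  induction h with
  | zero =>
    refine fun {S} _ => ⟨∅, Set.empty_subset _, trivial, fun l hl => ⟨[], chainIn_nil _, rfl, ?_⟩⟩
    exact fun x hx => absurd (hl.mem x hx) (Set.notMem_empty x)
  | succ h ih =>
    rintro S ⟨r, hr, A, hA, B, hB, hrA, hrB, hAB, hTA, hTB⟩
    obtain ⟨A', hA', hTA', hpA⟩ := ih hTA
    obtain ⟨B', hB', hTB', hpB⟩ := ih hTB
    have hrA' : ∀ x ∈ A', r < x := fun x hx => hrA x (hA' hx)
    have hrB' : ∀ x ∈ B', r < x := fun x hx => hrB x (hB' hx)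
    have hAB' : ∀ x ∈ A', ∀ y ∈ B', Incomp x y := fun x hx y hy => hAB x (hA' hx) y (hB' hy)
    have hBA' : ∀ x ∈ B', ∀ y ∈ A', Incomp x y := fun x hx y hy => (hAB' y hy x hx).symm
    refine ⟨insert r (A' ∪ B'), Set.insert_subset hr (Set.union_subset (hA'.trans hA)
      (hB'.trans hB)), ⟨r, Set.mem_insert _ _, A', fun x hx => Or.inr (Or.inl hx), B',
      fun x hx => Or.inr (Or.inr hx), hrA', hrB', hAB', hTA', hTB'⟩, ?_⟩
    have key : ∀ C : Set P, C ⊆ A' ∪ B' → (∀ x ∈ C, r < x) →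
        (∀ l, ChainIn C l → ∃ l', ChainIn C l' ∧ l'.length = h ∧ l ⊆ l') → ∀ l, ChainIn C l →
        ∃ l', ChainIn (insert r (A' ∪ B')) l' ∧ l'.length = h + 1 ∧ r :: l ⊆ l' := by
      intro C hC hrC hp l hl
      obtain ⟨l', hl', hlen, hsub⟩ := hp l hl
      exact ⟨r :: l', (hl'.mono (hC.trans (Set.subset_insert _ _))).cons (Set.mem_insert _ _)
        fun y hy => hrC y (hl'.mem y hy), by simp [hlen], List.cons_subset_cons _ hsub⟩
    have keyA := key A' Set.subset_union_left hrA' hpA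
    have keyB := key B' Set.subset_union_right hrB' hpB
    have main : ∀ x l, ChainIn (insert r (A' ∪ B')) (x :: l) → x ∈ A' ∪ B' →
        ∃ l', ChainIn (insert r (A' ∪ B')) l' ∧ l'.length = h + 1 ∧ r :: x :: l ⊆ l' := by
      rintro x l hl (hx | hx)
      · exact keyA _ (hl.of_head_mem hrA' hAB' hx)
      · refine keyB _ (ChainIn.of_head_mem hrB' hBA' hx ?_)
        rwa [Set.union_comm]
    rintro (_ | ⟨x, l⟩) hl
    · obtain ⟨l', h1, h2, -⟩ := keyA [] (chainIn_nil _)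
      exact ⟨l', h1, h2, by simp⟩
    · rcases hl.mem x List.mem_cons_self with rfl | hx
      · rcases l with _ | ⟨y, l⟩
        · exact keyA [] (chainIn_nil _)
        · refine main y l hl.tail ?_
          rcases hl.tail.mem y List.mem_cons_self with rfl | hy
          · exact absurd ((List.pairwise_cons.1 hl.pairwise).1 y List.mem_cons_self) (lt_irrefl y)
          · exact hy
      · obtain ⟨l', h1, h2, h3⟩ := main x l hl hx
        exact ⟨l', h1, h2, fun z hz => h3 (List.mem_cons_of_mem _ hz)⟩

theorem Tall.exists_chain {H : ℕ} (h : ℕ) : ∀ {S : Set P}, Tall (h + H) S →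
    ∃ l, ChainIn S l ∧ l.length = h ∧ ∃ A ⊆ S, Tall H A ∧ ∀ x ∈ l, ∀ a ∈ A, x < a := by
  induction h with
  | zero =>
    refine fun {S} hS => ⟨[], chainIn_nil _, rfl, S, subset_rfl, by simpa using hS, by simp⟩
  | succ h ih =>
    intro S hS
    rw [show h + 1 + H = h + H + 1 by omega] at hS
    obtain ⟨r, hr, A, hA, -, -, hrA, -, -, hTA, -⟩ := hS
    obtain ⟨l, hl, hlen, A', hA', hT, hlt⟩ := ih hTA
    refine ⟨r :: l, (hl.mono hA).cons hr fun y hy => hrA y (hl.mem y hy), by simp [hlen], A',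
      hA'.trans hA, hT, ?_⟩
    intro x hx a ha
    rcases List.mem_cons.1 hx with rfl | hx
    · exact hrA a (hA' ha)
    · exact hlt x hx a ha

/-- Cutting a tree down to a list of known length bounds the number of its chains of a given length
in terms of the height alone. -/
theorem Tall.exists_list {t : ℕ} : ∀ {S : Set P}, Tall t S →
    ∃ l : List P, l.length = 2 ^ t - 1 ∧ (∀ x ∈ l, x ∈ S) ∧ Tall t {x | x ∈ l} := by
  induction t with
  | zero => exact fun {S} _ => ⟨[], rfl, by simp, trivial⟩
  | succ t ih =>
    rintro S ⟨r, hr, A, hA, B, hB, hrA, hrB, hAB, hTA, hTB⟩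
    obtain ⟨l₁, hl₁, hm₁, hT₁⟩ := ih hTA
    obtain ⟨l₂, hl₂, hm₂, hT₂⟩ := ih hTB
    refine ⟨r :: (l₁ ++ l₂), ?_, ?_, r, by simp, {x | x ∈ l₁}, ?_, {x | x ∈ l₂}, ?_,
      fun a ha => hrA a (hm₁ a ha), fun a ha => hrB a (hm₂ a ha),
      fun a ha b hb => hAB a (hm₁ a ha) b (hm₂ b hb), hT₁, hT₂⟩
    · have := Nat.one_le_two_pow (n := t)
      simp only [List.length_cons, List.length_append, hl₁, hl₂, pow_succ]
      omega
    · intro x hx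
      simp only [List.mem_cons, List.mem_append] at hx
      rcases hx with rfl | hx | hx
      exacts [hr, hA (hm₁ x hx), hB (hm₂ x hx)]
    · intro x hx
      simp only [Set.mem_ofPred_eq] at hx
      simp [hx]
    · intro x hx
      simp only [Set.mem_ofPred_eq] at hx
      simp [hx]

/-! ### Chains in several trees at once. -/

/-- The property `χ` holds of all concatenations `u ++ l₁ ++ ⋯ ++ l_E`, where `l_i` is a chain with
the property `p` in the `i`-th set of the list. -/
def ForallChains (p χ : List P → Prop) : List P → List (Set P) → Prop
  | u, [] => χ u
  | u, S :: Ss => ∀ l, ChainIn S l → p l → ForallChains p χ (u ++ l) Ss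

/-- The sets of the first list are subsets of those of the second that have copies of the binary tree
of height `t`. -/
def Refines (t : ℕ) (Ss' Ss : List (Set P)) : Prop :=
  List.Forall₂ (fun S' S => S' ⊆ S ∧ Tall t S') Ss' Ss

theorem Refines.trans {t t' : ℕ} : ∀ {Ss'' Ss' Ss : List (Set P)}, Refines t Ss'' Ss' →
    Refines t' Ss' Ss → Refines t Ss'' Ss
  | _, _, _, .nil, .nil => .nil
  | _, _, _, .cons h hs, .cons h' hs' => .cons ⟨h.1.trans h'.1, h.2⟩ (Refines.trans hs hs')

theorem Refines.length_eq {t : ℕ} {Ss' Ss : List (Set P)} (h : Refines t Ss' Ss) :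
    Ss'.length = Ss.length := List.Forall₂.length_eq h

theorem Refines.tall {t : ℕ} : ∀ {Ss' Ss : List (Set P)}, Refines t Ss' Ss →
    ∀ S ∈ Ss', Tall t S
  | _, _, .nil => by simp
  | _, _, .cons h hs => by
    intro S hS
    rcases List.mem_cons.1 hS with rfl | hS
    exacts [h.2, Refines.tall hs S hS]

theorem refines_self {t : ℕ} : ∀ {Ss : List (Set P)}, (∀ S ∈ Ss, Tall t S) → Refines t Ss Ss
  | [], _ => .nil
  | S :: _, h => .cons ⟨subset_rfl, h S List.mem_cons_self⟩
      (refines_self fun T hT => h T (List.mem_cons_of_mem _ hT))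

theorem Refines.of_le {t t' : ℕ} (htt : t ≤ t') {Ss' Ss : List (Set P)} (h : Refines t' Ss' Ss) :
    Refines t Ss' Ss := List.Forall₂.imp (fun _ _ hS => ⟨hS.1, hS.2.of_le htt⟩) h

theorem ForallChains.refine {p χ : List P → Prop} {t : ℕ} : ∀ {u : List P}
    {Ss' Ss : List (Set P)}, ForallChains p χ u Ss → Refines t Ss' Ss → ForallChains p χ u Ss'
  | _, _, _, h, .nil => h
  | _, _, _, h, .cons hS hs => fun l hl hp =>
      ForallChains.refine (h l (hl.mono hS.1) hp) hs

/-- The polarized form of Ramsey's theorem for the chains of a fixed length in binary trees. -/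
theorem polarized_ramsey (h E : ℕ) : ∀ t, ∃ H, ∀ Ss : List (Set P), Ss.length = E →
    (∀ S ∈ Ss, Tall H S) → ∀ (χ : List P → Prop) (u : List P), ∃ Ss', Refines t Ss' Ss ∧
      (ForallChains (fun l => l.length = h) χ u Ss' ∨
        ForallChains (fun l => l.length = h) (fun l => ¬ χ l) u Ss') := by
  induction E with
  | zero =>
    refine fun t => ⟨0, fun Ss hE _ χ u => ⟨[], ?_, em _⟩⟩
    rw [List.length_eq_zero_iff.1 hE]
    exact .nil
  | succ E ih =>
    -- A bounded number of prefixes is handled one after another: shrinking the trees further does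
    -- not destroy the homogeneity already reached.
    have iter : ∀ k t, ∃ H, ∀ Ss : List (Set P), Ss.length = E → (∀ S ∈ Ss, Tall H S) →
        ∀ (χ : List P → Prop) (X : List (List P)), X.length = k → ∃ Ss', Refines t Ss' Ss ∧
          ∀ u ∈ X, ForallChains (fun l => l.length = h) χ u Ss' ∨
            ForallChains (fun l => l.length = h) (fun l => ¬ χ l) u Ss' := by
      intro k
      induction k with
      | zero =>
        refine fun t => ⟨t, fun Ss _ hT χ X hX => ⟨Ss, refines_self hT, ?_⟩⟩
        simp [List.length_eq_zero_iff.1 hX]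
      | succ k ihk =>
        intro t
        obtain ⟨K, hK⟩ := ih t
        obtain ⟨H, hH⟩ := ihk K
        refine ⟨H, fun Ss hE hT χ X hX => ?_⟩
        obtain ⟨u, X, rfl⟩ := List.exists_cons_of_length_eq_add_one hX
        obtain ⟨S₁, hS₁, h₁⟩ := hH Ss hE hT χ X (by simpa using hX)
        obtain ⟨S₂, hS₂, h₂⟩ := hK S₁ (hS₁.length_eq.trans hE) hS₁.tall χ u
        refine ⟨S₂, hS₂.trans hS₁, fun u' hu' => ?_⟩
        rcases List.mem_cons.1 hu' with rfl | hu'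
        · exact h₂
        · exact (h₁ u' hu').imp (fun h => h.refine hS₂) fun h => h.refine hS₂
    intro t
    obtain ⟨K, hK⟩ := ramsey_chains (P := P) h t
    -- The first tree will be cut down to `2 ^ K - 1` elements, so this cardinality bounds the
    -- number of its chains of length `h`. The other trees are made homogeneous for each of these
    -- chains, and then the first tree is made homogeneous for the resulting colour.
    obtain ⟨H, hH⟩ := iter (Fintype.card (Fin h → Fin (2 ^ K - 1))) t
    refine ⟨H + K, fun Ss hE hT χ u => ?_⟩
    obtain ⟨S, Ss, rfl⟩ := List.exists_cons_of_length_eq_add_one hE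
    obtain ⟨L, hL, hLS, hLT⟩ := ((hT S List.mem_cons_self).of_le
      (Nat.le_add_left K H)).exists_list
    obtain ⟨Ss', hSs', hhom⟩ := hH Ss (by simpa using hE)
      (fun T hT' => (hT T (List.mem_cons_of_mem _ hT')).of_le (Nat.le_add_right H K)) χ
      ((Finset.univ : Finset (Fin h → Fin (2 ^ K - 1))).toList.map fun g =>
        u ++ List.ofFn fun i => L.get (Fin.cast hL.symm (g i))) (by simp)
    have hhom' : ∀ l, ChainIn {x | x ∈ L} l → l.length = h →
        ForallChains (fun l => l.length = h) χ (u ++ l) Ss' ∨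
          ForallChains (fun l => l.length = h) (fun l => ¬ χ l) (u ++ l) Ss' := by
      intro l hl hlen
      have hidx : ∀ i : Fin h, ∃ j : Fin (2 ^ K - 1),
          L.get (Fin.cast hL.symm j) = l.get (Fin.cast hlen.symm i) := by
        intro i
        obtain ⟨j, hj⟩ := List.get_of_mem (hl.mem _ (List.get_mem l (Fin.cast hlen.symm i)))
        exact ⟨Fin.cast hL j, hj⟩
      choose g hg using hidx
      refine hhom _ (List.mem_map.2 ⟨g, by simp, ?_⟩)
      congr 1
      subst hlen
      simp only [hg]
      exact List.ofFn_get l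
    obtain ⟨S', hS', hT', hS''⟩ := hK _ hLT
      fun l => ForallChains (fun l => l.length = h) χ (u ++ l) Ss'
    refine ⟨S' :: Ss', .cons ⟨fun x hx => hLS x (hS' hx), hT'⟩ hSs', ?_⟩
    rcases hS'' with hp | hn
    · exact Or.inl hp
    · exact Or.inr fun l hl hlen =>
        (hhom' l (hl.mono hS') hlen).resolve_left (hn l hl hlen)

/-! ### Consistent configurations of trees. -/

/-- All concatenations of `u` with chains in the sets of the list are consistent. -/
abbrev Compat (Con : List P → Prop) : List P → List (Set P) → Prop :=
  ForallChains (fun _ => True) Con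

theorem Compat.of_subset {Con : List P → Prop} (hCon : ∀ l l', l ⊆ l' → Con l' → Con l) :
    ∀ {u u' : List P} {Ss : List (Set P)}, Compat Con u' Ss → u ⊆ u' → Compat Con u Ss
  | _, _, [], h, hu => hCon _ _ hu h
  | _, _, _ :: _, h, hu => fun l hl hp => Compat.of_subset hCon (h l hl hp)
      (List.append_subset.2 ⟨fun _ hx => List.mem_append_left _ (hu hx),
        List.subset_append_right _ _⟩)

theorem Compat.con {Con : List P → Prop} : ∀ {u : List P} {Ss : List (Set P)},
    Compat Con u Ss → Con u
  | _, [], h => h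
  | u, _ :: _, h => by simpa using Compat.con (h [] (chainIn_nil _) trivial)

theorem Compat.tail {Con : List P → Prop} {u : List P} {S : Set P} {Ss : List (Set P)}
    (h : Compat Con u (S :: Ss)) : Compat Con u Ss := by
  simpa using h [] (chainIn_nil _) trivial

/-- Putting `r` in front of a chain of elements above it gives another chain of `S`, so `r` can be
moved to the fixed part. -/
theorem Compat.cons_root {Con : List P → Prop} (hCon : ∀ l l', l ⊆ l' → Con l' → Con l)
    {u : List P} {r : P} {S S' : Set P} {Ss : List (Set P)} (h : Compat Con u (S :: Ss))
    (hr : r ∈ S) (hS : S' ⊆ S) (hrS : ∀ x ∈ S', r < x) : Compat Con (r :: u) (S' :: Ss) := by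
  intro l hl _
  refine Compat.of_subset hCon (h (r :: l) ((hl.mono hS).cons hr fun y hy => hrS y (hl.mem y hy))
    trivial) fun x => ?_
  simp only [List.cons_append, List.mem_cons, List.mem_append]
  tauto

/-- If the concatenations with chains of length `h` are consistent, then all concatenations are, in
suitable subsets. -/
theorem ForallChains.exists_compat {Con : List P → Prop}
    (hCon : ∀ l l', l ⊆ l' → Con l' → Con l) {h : ℕ} : ∀ {u : List P} {Ss : List (Set P)},
    ForallChains (fun l => l.length = h) Con u Ss → (∀ S ∈ Ss, Tall h S) →
      ∃ Ss', Refines h Ss' Ss ∧ Compat Con u Ss' := by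
  have key : ∀ {Ss : List (Set P)}, (∀ S ∈ Ss, Tall h S) → ∃ Ss', Refines h Ss' Ss ∧
      ∀ u, ForallChains (fun l => l.length = h) Con u Ss → Compat Con u Ss' := by
    intro Ss
    induction Ss with
    | nil => exact fun _ => ⟨[], .nil, fun u hu => hu⟩
    | cons S Ss ih =>
      intro hT
      obtain ⟨Ss', hSs', hc⟩ := ih fun T hT' => hT T (List.mem_cons_of_mem _ hT')
      obtain ⟨S', hS', hTS', hp⟩ := (hT S List.mem_cons_self).exists_pure
      refine ⟨S' :: Ss', .cons ⟨hS', hTS'⟩ hSs', fun u hu l hl _ => ?_⟩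
      -- In a pure tree every chain is contained in one of length exactly `h`, and consistency
      -- passes to sublists.
      obtain ⟨l', hl', hlen, hsub⟩ := hp l hl
      refine Compat.of_subset hCon (hc _ (hu l' (hl'.mono hS') hlen)) ?_
      exact List.append_subset.2 ⟨List.subset_append_left _ _,
        fun _ hx => List.mem_append_right _ (hsub hx)⟩
  intro u Ss hu hT
  obtain ⟨Ss', h1, h2⟩ := key hT
  exact ⟨Ss', h1, h2 u hu⟩

/-! ### The splittable case: growing an `m`-branching tree inside a consistent list. -/

/-- In every consistent configuration of sufficiently high trees, the first tree can be replaced by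
two incomparable trees inside it, after shrinking the other trees. -/
def Splittable (Con : List P → Prop) : Prop :=
  ∀ s E h : ℕ, ∃ H, ∀ u : List P, u.length = s → ∀ (S : Set P) (Ss : List (Set P)),
    Ss.length = E → (∀ T ∈ S :: Ss, Tall H T) → Compat Con u (S :: Ss) →
      ∃ A ⊆ S, ∃ B ⊆ S, ∃ Ss', (∀ a ∈ A, ∀ b ∈ B, Incomp a b) ∧ Tall h A ∧ Tall h B ∧
        Refines h Ss' Ss ∧ Compat Con u (A :: B :: Ss')

/-- The set `F` contains a copy of the complete `m`-branching tree with `j + 1` levels. -/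
def HasBlob (m : ℕ) : ℕ → Set P → Prop
  | 0, F => F.Nonempty
  | j + 1, F => ∃ r ∈ F, ∃ G : List (Set P), G.length = m ∧
      (∀ A ∈ G, A ⊆ F ∧ (∀ a ∈ A, r < a) ∧ HasBlob m j A) ∧
      G.Pairwise fun A B => ∀ a ∈ A, ∀ b ∈ B, Incomp a b

/-- Every consistent configuration of sufficiently high trees remains consistent when the elements of
a suitable subset of the first tree with the property `Q` are added, and the trees are replaced by
smaller ones, the first one by one incomparable to the new elements. -/
def ExtendableBy (Con : List P → Prop) (Q : Set P → Prop) : Prop :=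
  ∀ s E, ∃ s', ∀ h, ∃ H, ∀ u : List P, u.length = s → ∀ (S : Set P) (Ss : List (Set P)),
    Ss.length = E → (∀ T ∈ S :: Ss, Tall H T) → Compat Con u (S :: Ss) →
    ∃ u' : List P, u'.length = s' ∧ u ⊆ u' ∧ ∃ F ⊆ S, Q F ∧ (∀ x ∈ F, x ∈ u') ∧
      ∃ S' Ss', Refines h (S' :: Ss') (S :: Ss) ∧ (∀ x ∈ F, ∀ y ∈ S', Incomp x y) ∧
        Compat Con u' (S' :: Ss')

/-- Each new set is found in the remaining part of the first tree, which is incomparable to the sets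
found before. The list lengths are computed forwards from `s` and the heights backwards from `h`;
this works because `s'` in `ExtendableBy` does not depend on `h`. -/
theorem ExtendableBy.iterate {Con : List P → Prop} {Q : Set P → Prop} (hQ : ExtendableBy Con Q)
    (k : ℕ) : ∀ s E, ∃ s', ∀ h, ∃ H, ∀ u : List P, u.length = s →
      ∀ (S : Set P) (Ss : List (Set P)), Ss.length = E → (∀ T ∈ S :: Ss, Tall H T) →
      Compat Con u (S :: Ss) → ∃ u' : List P, u'.length = s' ∧ u ⊆ u' ∧
        ∃ G : List (Set P), G.length = k ∧ (∀ A ∈ G, A ⊆ S ∧ Q A ∧ ∀ x ∈ A, x ∈ u') ∧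
        (G.Pairwise fun A B => ∀ a ∈ A, ∀ b ∈ B, Incomp a b) ∧
        ∃ S' Ss', Refines h (S' :: Ss') (S :: Ss) ∧ Compat Con u' (S' :: Ss') := by
  induction k with
  | zero =>
    exact fun s E => ⟨s, fun h => ⟨h, fun u hu S Ss _ hT hc => ⟨u, hu, fun _ => id, [], rfl,
      by simp, List.Pairwise.nil, S, Ss, refines_self hT, hc⟩⟩⟩
  | succ k ih =>
    intro s E
    obtain ⟨s₁, h₁⟩ := hQ s E
    obtain ⟨s₂, h₂⟩ := ih s₁ E
    refine ⟨s₂, fun h => ?_⟩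
    obtain ⟨K, hK⟩ := h₂ h
    obtain ⟨H, hH⟩ := h₁ K
    refine ⟨H, fun u hu S Ss hE hT hc => ?_⟩
    obtain ⟨u₁, hu₁, huu, F, hFS, hQF, hFu, S₁, Ss₁, hR₁, hF, hc₁⟩ := hH u hu S Ss hE hT hc
    have hS₁ : S₁ ⊆ S := (List.forall₂_cons.1 hR₁).1.1
    obtain ⟨u₂, hu₂, huu₂, G, hG, hGA, hGp, S₂, Ss₂, hR₂, hc₂⟩ := hK u₁ hu₁ S₁ Ss₁
      ((Refines.length_eq (List.forall₂_cons.1 hR₁).2).trans hE) hR₁.tall hc₁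
    refine ⟨u₂, hu₂, fun x hx => huu₂ (huu hx), F :: G, by simp [hG], ?_, ?_, S₂, Ss₂,
      hR₂.trans hR₁, hc₂⟩
    · intro A hA
      rcases List.mem_cons.1 hA with rfl | hA
      · exact ⟨hFS, hQF, fun x hx => huu₂ (hFu x hx)⟩
      · exact ⟨(hGA A hA).1.trans hS₁, (hGA A hA).2⟩
    · exact List.pairwise_cons.2 ⟨fun B hB a ha b hb => hF a ha b ((hGA B hB).1 hb), hGp⟩

/-- Split the first tree into `A` and `B`. Inside `A`, a root and `m` incomparable smaller blobs
above it form the new blob, while `B` is carried along as one of the other trees. At the end `B`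
takes over as the first tree, being incomparable to everything chosen in `A`. -/
theorem Splittable.extendableBy_hasBlob {Con : List P → Prop}
    (hCon : ∀ l l' : List P, l ⊆ l' → Con l' → Con l) (hE : Splittable Con) (m j : ℕ) :
    ExtendableBy Con (HasBlob m j) := by
  induction j with
  | zero =>
    refine fun s E => ⟨s + 1, fun h => ?_⟩
    obtain ⟨H, hH⟩ := hE s E (h + 1)
    refine ⟨H, fun u hu S Ss hSs hT hc => ?_⟩
    obtain ⟨A, hA, B, hB, Ss', hAB, hTA, hTB, hR, hc'⟩ := hH u hu S Ss hSs hT hc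
    obtain ⟨r, hr, -⟩ := hTA
    refine ⟨r :: u, by simp [hu], List.subset_cons_self _ _, {r}, by simpa using hA hr,
      Set.singleton_nonempty r, by simp, B, Ss', .cons ⟨hB, hTB.of_succ⟩ (hR.of_le h.le_succ),
      by simpa using hAB r hr, ?_⟩
    -- Only `r` is needed from `A`, so `A` is shrunk to the empty set and dropped.
    exact (hc'.cons_root hCon hr (Set.empty_subset A) (by simp)).tail
  | succ j ih =>
    intro s E
    -- One more fixed element for the root `r`, and one more tree for `B`.
    obtain ⟨s', h'⟩ := ih.iterate m (s + 1) (E + 1)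
    refine ⟨s', fun h => ?_⟩
    obtain ⟨K, hK⟩ := h' h
    obtain ⟨H, hH⟩ := hE s E (K + 1)
    refine ⟨H, fun u hu S Ss hSs hT hc => ?_⟩
    obtain ⟨A, hA, B, hB, Ss', hAB, hTA, hTB, hR, hc'⟩ := hH u hu S Ss hSs hT hc
    obtain ⟨r, hr, A', hA', -, -, hrA, -, -, hTA', -⟩ := hTA
    obtain ⟨u', hu', huu, G, hG, hGA, hGp, A'', Ss'', hR', hc''⟩ := hK (r :: u) (by simp [hu]) A'
      (B :: Ss') (by simp [hR.length_eq, hSs]) (by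
        intro T hT'
        rcases List.mem_cons.1 hT' with rfl | hT'
        · exact hTA'
        rcases List.mem_cons.1 hT' with rfl | hT'
        · exact hTB.of_succ
        · exact (hR.tall T hT').of_succ) (hc'.cons_root hCon hr hA' hrA)
    cases hR' with
    | cons h1 h2 => cases h2 with
      | @cons B' _ Ss'' _ hB' hSs'' =>
        refine ⟨u', hu', fun x hx => huu (List.mem_cons_of_mem _ hx),
          {x | x = r ∨ ∃ X ∈ G, x ∈ X}, ?_, ⟨r, Or.inl rfl, G, hG, fun X hX =>
          ⟨fun x hx => Or.inr ⟨X, hX, hx⟩, fun x hx => hrA x ((hGA X hX).1 hx), (hGA X hX).2.1⟩,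
          hGp⟩, ?_, B', Ss'', .cons ⟨hB'.1.trans hB, hB'.2⟩ (Refines.trans hSs'' hR), ?_,
          hc''.tail⟩
        · rintro x (rfl | ⟨X, hX, hx⟩)
          exacts [hA hr, hA (hA' ((hGA X hX).1 hx))]
        · rintro x (rfl | ⟨X, hX, hx⟩)
          exacts [huu List.mem_cons_self, (hGA X hX).2.2 x hx]
        · rintro x (rfl | ⟨X, hX, hx⟩) y hy
          exacts [hAB _ hr y (hB'.1 hy), hAB x (hA' ((hGA X hX).1 hx)) y (hB'.1 hy)]

theorem HasBlob.exists_map {m : ℕ} : ∀ {j : ℕ} {F : Set P}, HasBlob m j F →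
    ∃ f : List (Fin m) → P, (∀ s, s.length ≤ j → f s ∈ F) ∧
      (∀ s t, s.length ≤ j → t.length ≤ j → s <+: t → s ≠ t → f s < f t) ∧
      ∀ s t, s.length ≤ j → t.length ≤ j → ¬ s <+: t → ¬ t <+: s → Incomp (f s) (f t) := by
  intro j
  induction j with
  | zero =>
    rintro F ⟨r, hr⟩
    refine ⟨fun _ => r, fun _ _ => hr, ?_, ?_⟩
    · intro s t hs ht _ hne
      simp only [Nat.le_zero, List.length_eq_zero_iff] at hs ht
      exact absurd (hs.trans ht.symm) hne
    · intro s t hs ht hst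
      simp only [Nat.le_zero, List.length_eq_zero_iff] at hs ht
      exact absurd (hs ▸ List.nil_prefix) hst
  | succ j ih =>
    rintro F ⟨r, hr, G, hG, hGA, hGp⟩
    subst hG
    choose g hgF hglt hginc using fun i : Fin G.length =>
      ih (hGA (G.get i) (List.get_mem G i)).2.2
    refine ⟨fun s => match s with
      | [] => r
      | i :: s => g i s, ?_, ?_, ?_⟩
    · rintro (_ | ⟨i, s⟩) hs
      · exact hr
      · exact (hGA _ (List.get_mem G i)).1 (hgF i s (by simpa using hs))
    · rintro (_ | ⟨i, s⟩) (_ | ⟨i', t⟩) hs ht hst hne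
      · exact absurd rfl hne
      · exact (hGA _ (List.get_mem G i')).2.1 _ (hgF i' t (by simpa using ht))
      · simp at hst
      · obtain ⟨rfl, hst'⟩ := List.cons_prefix_cons.1 hst
        exact hglt i s t (by simpa using hs) (by simpa using ht) hst' fun h => hne (by rw [h])
    · rintro (_ | ⟨i, s⟩) (_ | ⟨i', t⟩) hs ht hst hts
      · simp at hst
      · simp at hst
      · simp at hts
      · by_cases hi : i = i'
        · subst hi
          exact hginc i s t (by simpa using hs) (by simpa using ht)
            (fun h => hst (List.cons_prefix_cons.2 ⟨rfl, h⟩))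
            fun h => hts (List.cons_prefix_cons.2 ⟨rfl, h⟩)
        · have h1 := hgF i s (by simpa using hs)
          have h2 := hgF i' t (by simpa using ht)
          rcases lt_or_gt_of_ne hi with hlt | hlt
          · exact List.pairwise_iff_get.1 hGp i i' hlt _ h1 _ h2
          · exact (List.pairwise_iff_get.1 hGp i' i hlt _ h2 _ h1).symm

/-! ### The unsplittable case: trees of pairwise inconsistent chains. -/

/-- A family of chains of length `h` in `S`, indexed by the nodes of the binary tree with `t` levels,
that respects the order and the incomparability of the nodes. -/
structure ChainTree (h t : ℕ) (S : Set P) (c : List Bool → List P) : Prop where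
  chainIn : ∀ σ, σ.length < t → ChainIn S (c σ)
  length_eq : ∀ σ, σ.length < t → (c σ).length = h
  lt : ∀ σ τ, τ.length < t → σ <+: τ → σ ≠ τ → ∀ x ∈ c σ, ∀ y ∈ c τ, x < y
  incomp : ∀ σ τ, σ.length < t → τ.length < t → ¬ σ <+: τ → ¬ τ <+: σ →
    ∀ x ∈ c σ, ∀ y ∈ c τ, Incomp x y

/-- The chains at the initial segments of `τ`, concatenated by increasing length of the segment,
form a single chain. -/
theorem ChainTree.exists_chainIn {h t : ℕ} {S : Set P} {c : List Bool → List P}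
    (hc : ChainTree h t S c) (τ : List Bool) (hτ : τ.length < t) :
    ∃ l, ChainIn S l ∧ ∀ σ, σ <+: τ → c σ ⊆ l := by
  refine ⟨(List.range (τ.length + 1)).flatMap fun i => c (τ.take i), ⟨?_, ?_⟩, ?_⟩
  · refine List.pairwise_flatMap.2 ⟨fun i _ => (hc.chainIn _ ?_).pairwise, ?_⟩
    · exact lt_of_le_of_lt (List.length_take_le' i τ) hτ
    · refine List.Pairwise.imp_of_mem ?_ List.pairwise_lt_range
      intro i j _ hj hij x hx y hy
      have hj' : j ≤ τ.length := Nat.lt_succ_iff.1 (List.mem_range.1 hj)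
      refine hc.lt _ _ (lt_of_le_of_lt (List.length_take_le' j τ) hτ) ?_ ?_ x hx y hy
      · exact List.take_prefix_take_left hij.le
      · intro heq
        have := congrArg List.length heq
        simp only [List.length_take] at this
        omega
  · intro x hx
    obtain ⟨i, -, hx⟩ := List.mem_flatMap.1 hx
    exact (hc.chainIn _ (lt_of_le_of_lt (List.length_take_le' i τ) hτ)).mem x hx
  · intro σ hσ x hx
    refine List.mem_flatMap.2 ⟨σ.length, List.mem_range.2 (Nat.lt_succ_iff.2 hσ.length_le), ?_⟩
    rwa [← List.prefix_iff_eq_take.1 hσ]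

/-- The family of chains with the chain `l` at the root and the families `c₀` and `c₁` above it. -/
def joinTrees (l : List P) (c₀ c₁ : List Bool → List P) : List Bool → List P
  | [] => l
  | false :: σ => c₀ σ
  | true :: σ => c₁ σ

theorem ChainTree.join {h t : ℕ} {S A B : Set P} {l : List P} {c₀ c₁ : List Bool → List P}
    (hl : ChainIn S l) (hlen : l.length = h) (hA : A ⊆ S) (hB : B ⊆ S)
    (hlA : ∀ x ∈ l, ∀ a ∈ A, x < a) (hlB : ∀ x ∈ l, ∀ b ∈ B, x < b)
    (hAB : ∀ a ∈ A, ∀ b ∈ B, Incomp a b) (h₀ : ChainTree h t A c₀) (h₁ : ChainTree h t B c₁) :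
    ChainTree h (t + 1) S (joinTrees l c₀ c₁) := by
  refine ⟨?_, ?_, ?_, ?_⟩
  · rintro (_ | ⟨_ | _, σ⟩) hσ
    · exact hl
    · exact (h₀.chainIn σ (by simpa using hσ)).mono hA
    · exact (h₁.chainIn σ (by simpa using hσ)).mono hB
  · rintro (_ | ⟨_ | _, σ⟩) hσ
    · exact hlen
    · exact h₀.length_eq σ (by simpa using hσ)
    · exact h₁.length_eq σ (by simpa using hσ)
  · rintro (_ | ⟨i, σ⟩) (_ | ⟨i', τ⟩) hτ hστ hne x hx y hy
    · exact absurd rfl hne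
    · cases i'
      · exact hlA x hx y ((h₀.chainIn τ (by simpa using hτ)).mem y hy)
      · exact hlB x hx y ((h₁.chainIn τ (by simpa using hτ)).mem y hy)
    · simp at hστ
    · obtain ⟨rfl, hστ'⟩ := List.cons_prefix_cons.1 hστ
      have hne' : σ ≠ τ := fun h => hne (by rw [h])
      cases i
      · exact h₀.lt σ τ (by simpa using hτ) hστ' hne' x hx y hy
      · exact h₁.lt σ τ (by simpa using hτ) hστ' hne' x hx y hy
  · rintro (_ | ⟨i, σ⟩) (_ | ⟨i', τ⟩) hσ hτ hστ hτσ x hx y hy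
    · simp at hστ
    · simp at hστ
    · simp at hτσ
    · simp only [List.cons_prefix_cons, not_and] at hστ hτσ
      have hσ' : σ.length < t := by simpa using hσ
      have hτ' : τ.length < t := by simpa using hτ
      cases i <;> cases i'
      · exact h₀.incomp σ τ hσ' hτ' (hστ rfl) (hτσ rfl) x hx y hy
      · exact hAB x ((h₀.chainIn σ hσ').mem x hx) y ((h₁.chainIn τ hτ').mem y hy)
      · exact (hAB y ((h₀.chainIn τ hτ').mem y hy) x ((h₁.chainIn σ hσ').mem x hx)).symm
      · exact h₁.incomp σ τ hσ' hτ' (hστ rfl) (hτσ rfl) x hx y hy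

/-- The first tree of the configuration cannot be replaced by two incomparable trees of height `h`
inside it, whatever subtrees of height `h` of the other trees are chosen. -/
def Stuck (Con : List P → Prop) (h : ℕ) (u : List P) (S : Set P) (Ss : List (Set P)) : Prop :=
  ∀ A ⊆ S, ∀ B ⊆ S, ∀ Ss', (∀ a ∈ A, ∀ b ∈ B, Incomp a b) → Tall h A → Tall h B →
    Refines h Ss' Ss → ¬ Compat Con u (A :: B :: Ss')

theorem Stuck.refine {Con : List P → Prop} {h t : ℕ} {u : List P} {S S' : Set P}
    {Ss Ss' : List (Set P)} (hS : Stuck Con h u S Ss) (hS' : S' ⊆ S) (hR : Refines t Ss' Ss) :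
    Stuck Con h u S' Ss' :=
  fun A hA B hB Ss'' hAB hTA hTB hR' =>
    hS A (hA.trans hS') B (hB.trans hS') Ss'' hAB hTA hTB (hR'.trans hR)

/-- Apply `polarized_ramsey` to `A`, `B` and the other trees. The consistent alternative extends to
chains of all lengths by `ForallChains.exists_compat` and would give a splitting of height `h`; the
summand `h` in `t + h` leaves room for this. -/
theorem exists_forallChains_not {Con : List P → Prop} (hCon : ∀ l l', l ⊆ l' → Con l' → Con l)
    (h E t : ℕ) : ∃ H, ∀ (u : List P) (S : Set P) (Ss : List (Set P)), Ss.length = E →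
      Stuck Con h u S Ss → ∀ A ⊆ S, ∀ B ⊆ S, (∀ a ∈ A, ∀ b ∈ B, Incomp a b) →
      Tall H A → Tall H B → (∀ T ∈ Ss, Tall H T) → ∃ A' ⊆ A, ∃ B' ⊆ B, ∃ Ss', Tall t A' ∧
        Tall t B' ∧ Refines t Ss' Ss ∧
        ForallChains (fun l => l.length = h) (fun l => ¬ Con l) u (A' :: B' :: Ss') := by
  obtain ⟨H, hH⟩ := polarized_ramsey (P := P) h (E + 2) (t + h)
  refine ⟨H, fun u S Ss hE hS A hA B hB hAB hTA hTB hT => ?_⟩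
  obtain ⟨Ts, hR, hor⟩ := hH (A :: B :: Ss) (by simp [hE]) (by
    simpa [hTA, hTB] using hT) Con u
  cases hR with | @cons A' _ Ts _ hA' hR => ?_
  cases hR with | @cons B' _ Ss' _ hB' hR => ?_
  rcases hor with hc | hn
  · exfalso
    obtain ⟨Ts, hR', hc'⟩ := hc.exists_compat hCon (by
      intro T hT
      rcases List.mem_cons.1 hT with rfl | hT
      · exact hA'.2.of_le (Nat.le_add_left _ _)
      rcases List.mem_cons.1 hT with rfl | hT
      · exact hB'.2.of_le (Nat.le_add_left _ _)
      exact (Refines.tall hR T hT).of_le (Nat.le_add_left _ _))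
    cases hR' with | @cons A₁ _ Ts _ hA₁ hR' => ?_
    cases hR' with | @cons B₁ _ Ss₁ _ hB₁ hR' => ?_
    exact hS A₁ (hA₁.1.trans (hA'.1.trans hA)) B₁ (hB₁.1.trans (hB'.1.trans hB)) Ss₁
      (fun a ha b hb => hAB a (hA'.1 (hA₁.1 ha)) b (hB'.1 (hB₁.1 hb))) hA₁.2 hB₁.2
      (Refines.trans hR' hR) hc'
  · exact ⟨A', hA'.1, B', hB'.1, Ss', hA'.2.of_le (Nat.le_add_right _ _),
      hB'.2.of_le (Nat.le_add_right _ _), Refines.of_le (Nat.le_add_right _ _) hR, hn⟩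

/-- In a stuck configuration of sufficiently high trees there is a tree of chains such that
incomparable chains are inconsistent, uniformly over the other trees. -/
theorem Stuck.exists_chainTree {Con : List P → Prop} (hCon : ∀ l l', l ⊆ l' → Con l' → Con l)
    (h E t : ℕ) : ∀ q, ∃ H, ∀ (u : List P) (S : Set P) (Ss : List (Set P)), Ss.length = E →
      Stuck Con h u S Ss → (∀ T ∈ S :: Ss, Tall H T) → ∃ c, ChainTree h t S c ∧
        ∃ Ss', Refines q Ss' Ss ∧ ∀ σ τ, σ.length < t → τ.length < t → ¬ σ <+: τ → ¬ τ <+: σ →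
          ForallChains (fun l => l.length = h) (fun l => ¬ Con l) (u ++ c σ ++ c τ) Ss' := by
  have hnot : ∀ l l' : List P, l ⊆ l' → ¬ Con l → ¬ Con l' := fun l l' hl hn hc =>
    hn (hCon l l' hl hc)
  have hsub : ∀ {p : List P → Prop} {u u' : List P} {Ss : List (Set P)}, u ⊆ u' →
      ForallChains p (fun l => ¬ Con l) u Ss → ForallChains p (fun l => ¬ Con l) u' Ss := by
    intro p u u' Ss hu hF
    induction Ss generalizing u u' with
    | nil => exact hnot _ _ hu hF
    | cons S Ss ih =>
      exact fun l hl hp => ih (List.append_subset.2 ⟨fun _ hx => List.mem_append_left _ (hu hx),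
        List.subset_append_right _ _⟩) (hF l hl hp)
  induction t with
  | zero =>
    refine fun q => ⟨q, fun u S Ss _ _ hT => ⟨fun _ => [], ?_, Ss, refines_self
      fun T hT' => hT T (List.mem_cons_of_mem _ hT'), by simp⟩⟩
    exact ⟨by simp, by simp, by simp, by simp⟩
  | succ t ih =>
    intro q
    obtain ⟨K, hK⟩ := ih q
    -- The left subtree is treated first and must leave the other trees of height `K`, as needed for
    -- the right subtree.
    obtain ⟨K', hK'⟩ := ih K
    obtain ⟨H, hH⟩ := exists_forallChains_not hCon h E (K + K')
    -- The lowest `h` levels supply the chain at the root, and one more level is spent on the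
    -- branching into `A` and `B`. Inconsistency between chains of `A'` and `B'` is secured before
    -- the recursion inside them.
    refine ⟨h + (H + 1), fun u S Ss hE hS hT => ?_⟩
    obtain ⟨l, hl, hlen, R, hRS, hTR, hlR⟩ := (hT S List.mem_cons_self).exists_chain h
    obtain ⟨-, -, A, hA, B, hB, -, -, hAB, hTA, hTB⟩ := hTR
    obtain ⟨A', hA', B', hB', Ss₁, hTA', hTB', hR₁, hF⟩ := hH u S Ss hE hS A (hA.trans hRS) B
      (hB.trans hRS) hAB hTA hTB fun T hT' =>
        (hT T (List.mem_cons_of_mem _ hT')).of_le (by omega)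
    have hA'S : A' ⊆ S := hA'.trans (hA.trans hRS)
    have hB'S : B' ⊆ S := hB'.trans (hB.trans hRS)
    obtain ⟨c₀, hc₀, Ss₂, hR₂, hF₂⟩ := hK' u A' Ss₁ (hR₁.length_eq.trans hE)
      (hS.refine hA'S hR₁) (by
        intro T hT'
        rcases List.mem_cons.1 hT' with rfl | hT'
        exacts [hTA'.of_le (by omega), (hR₁.tall T hT').of_le (by omega)])
    have hR₂' := hR₂.trans hR₁
    obtain ⟨c₁, hc₁, Ss₃, hR₃, hF₃⟩ := hK u B' Ss₂ (hR₂'.length_eq.trans hE)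
      (hS.refine hB'S hR₂') (by
        intro T hT'
        rcases List.mem_cons.1 hT' with rfl | hT'
        exacts [hTB'.of_le (by omega), hR₂.tall T hT'])
    refine ⟨joinTrees l c₀ c₁, ChainTree.join hl hlen hA'S hB'S
      (fun x hx a ha => hlR x hx a (hA (hA' ha))) (fun x hx b hb => hlR x hx b (hB (hB' hb)))
      (fun a ha b hb => hAB a (hA' ha) b (hB' hb)) hc₀ hc₁, Ss₃, hR₃.trans hR₂', ?_⟩
    have hmix : ∀ σ τ, σ.length < t → τ.length < t →
        ForallChains (fun l => l.length = h) (fun l => ¬ Con l) (u ++ c₀ σ ++ c₁ τ) Ss₃ :=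
      fun σ τ hσ hτ => (hF _ (hc₀.chainIn σ hσ) (hc₀.length_eq σ hσ) _ (hc₁.chainIn τ hτ)
        (hc₁.length_eq τ hτ)).refine (hR₃.trans hR₂)
    rintro (_ | ⟨i, σ⟩) (_ | ⟨i', τ⟩) hσ hτ hστ hτσ
    · simp at hστ
    · simp at hστ
    · simp at hτσ
    · simp only [List.cons_prefix_cons, not_and] at hστ hτσ
      have hσ' : σ.length < t := by simpa using hσ
      have hτ' : τ.length < t := by simpa using hτ
      cases i <;> cases i'
      · exact (hF₂ σ τ hσ' hτ' (hστ rfl) (hτσ rfl)).refine hR₃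
      · exact hmix σ τ hσ' hτ'
      · refine hsub ?_ (hmix τ σ hτ' hσ')
        intro x
        simp only [joinTrees, List.mem_append]
        tauto
      · exact hF₃ σ τ hσ' hτ' (hστ rfl) (hτσ rfl)

/-- The dichotomy: either consistent configurations can be split, or there are arbitrarily high
trees of chains of bounded length such that incomparable chains are inconsistent. -/
theorem exists_chainTree_of_not_splittable {Con : List P → Prop}
    (hCon : ∀ l l', l ⊆ l' → Con l' → Con l) (hns : ¬ Splittable Con) (h₀ : ℕ) :
    ∃ s h, h₀ ≤ h ∧ ∀ t, ∃ (u : List P) (S : Set P) (c : List Bool → List P), u.length = s ∧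
      ChainTree h t S c ∧ (∀ l, ChainIn S l → Con (u ++ l)) ∧
      ∀ σ τ, σ.length < t → τ.length < t → ¬ σ <+: τ → ¬ τ <+: σ →
        ¬ Con (u ++ c σ ++ c τ) := by
  have hlist : ∀ (h : ℕ) {Ss : List (Set P)}, (∀ S ∈ Ss, Tall h S) →
      ∃ v : List P, v.length = Ss.length * h ∧
        (∀ u, Compat Con u Ss → Con (u ++ v)) ∧
        ∀ u, ForallChains (fun l => l.length = h) (fun l => ¬ Con l) u Ss → ¬ Con (u ++ v) := by
    intro h Ss
    induction Ss with
    | nil => exact fun _ => ⟨[], by simp, fun u hu => by rwa [List.append_nil],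
        fun u hu => by rwa [List.append_nil]⟩
    | cons S Ss ih =>
      intro hT
      obtain ⟨v, hv, hv₁, hv₂⟩ := ih fun T hT' => hT T (List.mem_cons_of_mem _ hT')
      obtain ⟨l, hl, hlen, -⟩ := Tall.exists_chain (H := 0) h (hT S List.mem_cons_self)
      refine ⟨l ++ v, ?_, fun u hu => ?_, fun u hu => ?_⟩
      · simp [hlen, hv, Nat.succ_mul, Nat.add_comm]
      · rw [← List.append_assoc]
        exact hv₁ _ (hu l hl trivial)
      · rw [← List.append_assoc]
        exact hv₂ _ (hu l hl hlen)
  simp only [Splittable, not_forall, not_exists] at hns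
  obtain ⟨s, E, h, hns⟩ := hns
  -- Unsplittability for height `h` persists for the larger height `h + h₀`, which makes the chains
  -- at least `h₀` long. One chain of that length from each of the `E` other trees is added to the
  -- fixed list.
  refine ⟨s + E * (h + h₀), h + h₀, Nat.le_add_left _ _, fun t => ?_⟩
  obtain ⟨H, hH⟩ := Stuck.exists_chainTree hCon (h + h₀) E t (h + h₀)
  obtain ⟨u, hu, S, Ss, hE, hT, hc, hno⟩ := hns H
  have hS : Stuck Con (h + h₀) u S Ss := fun A hA B hB Ss' hAB hTA hTB hR hc' =>
    hno A ⟨hA, B, hB, Ss', hAB, hTA.of_le (Nat.le_add_right _ _),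
      hTB.of_le (Nat.le_add_right _ _), hR.of_le (Nat.le_add_right _ _), hc'⟩
  obtain ⟨c, hct, Ss', hR, hF⟩ := hH u S Ss hE hS hT
  obtain ⟨v, hv, hv₁, hv₂⟩ := hlist (h + h₀) hR.tall
  refine ⟨u ++ v, S, c, by simp [hu, hv, hR.length_eq, hE], hct, fun l hl => ?_,
    fun σ τ hσ hτ hστ hτσ => ?_⟩
  · refine hCon _ (u ++ l ++ v) ?_ (hv₁ _ ((hc l hl trivial).refine hR))
    intro x
    simp only [List.mem_append]
    tauto
  · intro hcon
    refine hv₂ _ (hF σ τ hσ hτ hστ hτσ) (hCon _ _ ?_ hcon)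
    intro x
    simp only [List.mem_append]
    tauto

end Combinatorics

/-! ### Compactness for tree-indexed parameters. -/

section Compactness

open FirstOrder FirstOrder.Language

variable {L : FirstOrder.Language.{u, v}}

/-- The compactness theorem for sets of formulas with free variables in `V`. -/
theorem exists_model_realizing (T : L.Theory) {V : Type w} (Γ : Set (L.Formula V))
    (hΓ : ∀ Γ₀ : Finset (L.Formula V), (Γ₀ : Set (L.Formula V)) ⊆ Γ →
      ∃ (M : FirstOrder.Language.Theory.ModelType.{u, v, w'} T) (x : V → M),
        ∀ ψ ∈ Γ₀, ψ.Realize x) :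
    ∃ (M : FirstOrder.Language.Theory.ModelType.{u, v, max u v w} T) (x : V → M),
      ∀ ψ ∈ Γ, ψ.Realize x := by
  classical
  let T' : L[[V]].Theory := (L.lhomWithConstants V).onTheory T ∪ Formula.equivSentence '' Γ
  have hT' : T'.IsSatisfiable := by
    rw [Theory.isSatisfiable_iff_isFinitelySatisfiable]
    intro T₀ hT₀
    -- Only the sentences coming from `Γ` have to be arranged; those coming from `T` hold in every
    -- model of `T`.
    let Γ₀ : Finset (L.Formula V) :=
      (T₀.image Formula.equivSentence.symm).filter fun ψ => ψ ∈ Γ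
    obtain ⟨M, x, hx⟩ := hΓ Γ₀ fun ψ hψ => (Finset.mem_filter.1 hψ).2
    let _ : (constantsOn V).Structure M := constantsOn.structure x
    have hM : M ⊨ (T₀ : L[[V]].Theory) := by
      refine ⟨fun φ hφ => ?_⟩
      rcases hT₀ hφ with hφT | ⟨ψ, hψ, rfl⟩
      · have : M ⊨ (L.lhomWithConstants V).onTheory T :=
          (LHom.onTheory_model (L.lhomWithConstants V) T).2 M.is_model
        exact this.realize_of_mem φ hφT
      · rw [Formula.realize_equivSentence]
        refine hx ψ (Finset.mem_filter.2 ⟨Finset.mem_image.2 ⟨_, hφ, ?_⟩, hψ⟩)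
        simp
    exact Theory.Model.isSatisfiable M
  obtain ⟨N⟩ := hT'
  have hN : N ⊨ (L.lhomWithConstants V).onTheory T :=
    Theory.Model.mono N.is_model Set.subset_union_left
  let _ : L.Structure N := (L.lhomWithConstants V).reduct N
  have : (L.lhomWithConstants V).IsExpansionOn N := LHom.isExpansionOn_reduct _ _
  have : N ⊨ T := (LHom.onTheory_model (L.lhomWithConstants V) T).1 hN
  refine ⟨Theory.ModelType.of T N, fun a => (L.con a : N), fun ψ hψ => ?_⟩
  have := N.is_model.realize_of_mem _ (Or.inr ⟨ψ, hψ, rfl⟩)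
  exact (Formula.realize_equivSentence N ψ).1 this

variable {α β : Type}

/-- The formula expressing that the instances of `φ` at the elements of the finite set `F` have a
common solution. -/
noncomputable def existsCommon [Finite α] (φ : L.Formula (α ⊕ β)) {N : Type w} (F : Finset N) :
    L.Formula (N × β) :=
  Formula.iExs α (Formula.iInf fun η : F =>
    φ.relabel (Sum.elim Sum.inr fun j => Sum.inl (η.1, j)))

theorem realize_existsCommon [Finite α] {M : Type*} [L.Structure M] (φ : L.Formula (α ⊕ β))
    {N : Type w} (F : Finset N) (a : N × β → M) :
    (existsCommon φ F).Realize a ↔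
      ∃ x : α → M, ∀ η ∈ F, φ.Realize (Sum.elim x fun j => a (η, j)) := by
  simp only [existsCommon, Formula.realize_iExs, Formula.realize_iInf, Formula.realize_relabel,
    Subtype.forall]
  refine exists_congr fun x => forall₂_congr fun η _ => ?_
  rw [iff_iff_eq]
  congr 1
  ext (i | j) <;> rfl

/-- In some model of `T`, of the given universe, there are parameters indexed by `N` such that the
instances of `φ` at a finite chain in `D` have a common solution, and those at two incomparable
elements of `D` do not. -/
def RealizesTree (T : L.Theory) (φ : L.Formula (α ⊕ β)) {N : Type*} [PartialOrder N]
    (D : Set N) : Prop :=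
  ∃ (M : FirstOrder.Language.Theory.ModelType.{u, v, w} T) (a : N → β → M),
    (∀ F : Finset N, ↑F ⊆ D → IsChain (· ≤ ·) (F : Set N) →
      ∃ x : α → M, ∀ η ∈ F, φ.Realize (Sum.elim x (a η))) ∧
    ∀ η ∈ D, ∀ ν ∈ D, Incomp η ν →
      ¬ ∃ x : α → M, φ.Realize (Sum.elim x (a η)) ∧ φ.Realize (Sum.elim x (a ν))

/-- Both requirements on the parameters are sets of first-order formulas in variables indexed by `N
× β`. The models for the finite parts may lie in any universe `w'`, while the universe of the
resulting model depends only on `L` and `N`; in this way the model is brought into the universe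
demanded by each definition. -/
theorem RealizesTree.univ_of_finite [Finite α] {T : L.Theory} {φ : L.Formula (α ⊕ β)}
    {N : Type w} [PartialOrder N]
    (h : ∀ D : Finset N, RealizesTree.{u, v, w'} T φ (D : Set N)) :
    RealizesTree.{u, v, max u v w} T φ (Set.univ : Set N) := by
  classical
  let Γ : Set (L.Formula (N × β)) :=
    {ψ | ∃ F : Finset N, (IsChain (· ≤ ·) (F : Set N) ∧ ψ = existsCommon φ F) ∨
      ∃ η ν, Incomp η ν ∧ F = {η, ν} ∧ ψ = ∼(existsCommon φ F)}
  obtain ⟨M, x, hx⟩ := exists_model_realizing.{u, v, w, w'} T Γ (by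
    intro Γ₀ hΓ₀
    choose! F hF using fun ψ (hψ : ψ ∈ Γ₀) => hΓ₀ hψ
    obtain ⟨M, a, ha₁, ha₂⟩ := h (Γ₀.biUnion F)
    refine ⟨M, fun p => a p.1 p.2, fun ψ hψ => ?_⟩
    have hsub : F ψ ⊆ Γ₀.biUnion F := Finset.subset_biUnion_of_mem F hψ
    rcases hF ψ hψ with ⟨hc, hψF⟩ | ⟨η, ν, hi, hFe, hψF⟩
    · rw [hψF, realize_existsCommon]
      exact ha₁ (F ψ) (by exact_mod_cast hsub) hc
    · rw [hψF, Formula.realize_not, realize_existsCommon, hFe]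
      rintro ⟨x, hx⟩
      rw [hFe] at hsub
      exact ha₂ η (hsub (by simp)) ν (hsub (by simp)) hi
        ⟨x, hx η (by simp), hx ν (by simp)⟩)
  refine ⟨M, fun η j => x (η, j), fun F _ hF => ?_, fun η _ ν _ hi => ?_⟩
  · exact (realize_existsCommon φ F x).1 (hx _ ⟨F, Or.inl ⟨hF, rfl⟩⟩)
  · have := hx _ ⟨{η, ν}, Or.inr ⟨η, ν, hi, rfl, rfl⟩⟩
    rw [Formula.realize_not, realize_existsCommon] at this
    rintro ⟨y, hy₁, hy₂⟩
    refine this ⟨y, fun θ hθ => ?_⟩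
    rcases Finset.mem_insert.1 hθ with rfl | hθ
    · exact hy₁
    · rw [Finset.mem_singleton.1 hθ]
      exact hy₂

end Compactness

/-! ### The binary tree of ordinal height. -/

section BinaryTree

variable {I : Type w} [LinearOrder I]

instance BinNode.instPartialOrder : PartialOrder (BinNode I) where
  le := BinNode.IsInitial
  le_refl _ := ⟨le_rfl, fun _ => rfl⟩
  le_trans _ _ _ h₁ h₂ := ⟨h₁.1.trans h₂.1, fun i =>
    (h₂.2 ⟨i.1, i.2.trans_le h₁.1⟩).trans (h₁.2 i)⟩
  le_antisymm η ν h₁ h₂ := by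
    obtain ⟨α, f⟩ := η
    obtain ⟨β, g⟩ := ν
    obtain rfl : α = β := le_antisymm h₁.1 h₂.1
    congr 1
    exact funext fun i => (h₁.2 i).symm

namespace BinNode

theorem incomparable_iff {η ν : BinNode I} : η.Incomparable ν ↔ Incomp η ν := Iff.rfl

theorem isProperInitial_iff {η ν : BinNode I} : η.IsProperInitial ν ↔ η < ν :=
  (lt_iff_le_and_ne (a := η) (b := ν)).symm

theorem eq_of_le_of_len_le {η ν : BinNode I} (h : η ≤ ν) (hl : ν.len ≤ η.len) : η = ν :=
  le_antisymm h ⟨hl, fun i => (h.2 ⟨i.1, i.2.trans_le hl⟩).symm⟩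

theorem len_lt_of_lt {η ν : BinNode I} (h : η < ν) : η.len < ν.len :=
  lt_of_le_of_ne h.le.1 fun he => h.ne (eq_of_le_of_len_le h.le he.ge)

theorem le_total_of_le {η ν θ : BinNode I} (h₁ : η ≤ θ) (h₂ : ν ≤ θ) : η ≤ ν ∨ ν ≤ η := by
  rcases le_total η.len ν.len with h | h
  · exact Or.inl ⟨h, fun i => (h₂.2 ⟨i.1, i.2.trans_le h⟩).symm.trans (h₁.2 i)⟩
  · exact Or.inr ⟨h, fun i => (h₁.2 ⟨i.1, i.2.trans_le h⟩).symm.trans (h₂.2 i)⟩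

theorem Incomp.exists_ne {η ν : BinNode I} (h : Incomp η ν) :
    ∃ i, ∃ (h₁ : i < η.len) (h₂ : i < ν.len), η.val ⟨i, h₁⟩ ≠ ν.val ⟨i, h₂⟩ := by
  by_contra! hcon
  rcases le_total η.len ν.len with hl | hl
  · exact h.1 ⟨hl, fun i => (hcon i.1 i.2 (i.2.trans_le hl)).symm⟩
  · exact h.2 ⟨hl, fun i => hcon i.1 (i.2.trans_le hl) i.2⟩

theorem incomp_of_ne {η ν : BinNode I} {i : I} (h₁ : i < η.len) (h₂ : i < ν.len)
    (hne : η.val ⟨i, h₁⟩ ≠ ν.val ⟨i, h₂⟩) : Incomp η ν :=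
  ⟨fun h => hne (h.2 ⟨i, h₁⟩).symm, fun h => hne (h.2 ⟨i, h₂⟩)⟩

theorem restrict_le_restrict (η : I → Bool) {α β : I} (h : α ≤ β) :
    restrict η α ≤ restrict η β := ⟨h, fun _ => rfl⟩

/-- The extension of the sequence `r` to the length `α` by the constant value `b`. -/
noncomputable def extend (r : BinNode I) (b : Bool) (α : I) : BinNode I :=
  ⟨α, fun i => if h : i.1 < r.len then r.val ⟨i.1, h⟩ else b⟩

theorem lt_extend {r : BinNode I} (b : Bool) {α : I} (h : r.len < α) : r < r.extend b α :=
  lt_iff_le_and_ne.2 ⟨⟨h.le, fun i => dif_pos i.2⟩, fun he => h.ne (congrArg len he)⟩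

theorem incomp_extend {r : BinNode I} {α : I} (h : r.len < α) :
    Incomp (r.extend false α) (r.extend true α) := by
  refine incomp_of_ne (i := r.len) h h ?_
  simp [extend]

theorem incomp_of_le {η ν η' ν' : BinNode I} (h : Incomp η ν) (h₁ : η ≤ η') (h₂ : ν ≤ ν') :
    Incomp η' ν' := by
  refine ⟨fun hc => ?_, fun hc => ?_⟩
  · exact (le_total_of_le (h₁.trans hc) h₂).elim h.1 h.2
  · exact (le_total_of_le h₁ (h₂.trans hc)).elim h.1 h.2

/-- Extend `r` by one entry to get a root of successor length, then by `false` and by `true` to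
separate the two subtrees; as the height is a limit, there is always room for another step. -/
theorem tall_above [WellFoundedLT I] [NoMaxOrder I] (t : ℕ) (r : BinNode I) :
    Tall t {x : BinNode I | x.HasSuccLength ∧ r < x} := by
  induction t generalizing r with
  | zero => trivial
  | succ t ih =>
    obtain ⟨α, hα⟩ := exists_covBy_of_wellFoundedLT (not_isMax r.len)
    obtain ⟨β, hβ⟩ := exists_covBy_of_wellFoundedLT (not_isMax α)
    let r' := r.extend false α
    have hr : r < r' := lt_extend false hα.lt
    have hr' : ∀ b, r' < r'.extend b β := fun b => lt_extend b hβ.lt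
    refine ⟨r', ⟨⟨r.len, hα⟩, hr⟩, {x | x.HasSuccLength ∧ r'.extend false β < x},
      fun x hx => ⟨hx.1, hr.trans ((hr' _).trans hx.2)⟩,
      {x | x.HasSuccLength ∧ r'.extend true β < x},
      fun x hx => ⟨hx.1, hr.trans ((hr' _).trans hx.2)⟩, fun x hx => (hr' _).trans hx.2,
      fun x hx => (hr' _).trans hx.2, fun x hx y hy => ?_, ih _, ih _⟩
    exact incomp_of_le (incomp_extend hβ.lt) hx.2.le hy.2.le

theorem tall_hasSuccLength [WellFoundedLT I] [NoMaxOrder I] [Nonempty I] (t : ℕ) :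
    Tall t {x : BinNode I | x.HasSuccLength} :=
  (tall_above t (restrict (fun _ => false) (Classical.arbitrary I))).mono fun _ hx => hx.1

end BinNode

theorem exists_greatest_of_isChain {N : Type*} [PartialOrder N] {F : Finset N}
    (hF : IsChain (· ≤ ·) (F : Set N)) (hne : F.Nonempty) : ∃ m ∈ F, ∀ x ∈ F, x ≤ m := by
  obtain ⟨m, hm⟩ := F.exists_maximal hne
  refine ⟨m, hm.1, fun x hx => ?_⟩
  rcases hF.total hx hm.1 with h | h
  exacts [h, hm.2 hx h]

theorem BinNode.exists_branch {F : Finset (BinNode I)}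
    (hF : IsChain (· ≤ ·) (F : Set (BinNode I))) :
    ∃ η : I → Bool, ∀ x ∈ F, x = restrict η x.len := by
  rcases F.eq_empty_or_nonempty with rfl | hne
  · exact ⟨fun _ => false, by simp⟩
  obtain ⟨m, -, hm⟩ := exists_greatest_of_isChain hF hne
  refine ⟨fun i => if h : i < m.len then m.val ⟨i, h⟩ else false, fun x hx => ?_⟩
  refine eq_of_le_of_len_le ⟨le_rfl, fun i => ?_⟩ le_rfl
  have hi : i.1 < m.len := i.2.trans_le (hm x hx).1
  exact (dif_pos hi).trans ((hm x hx).2 i)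

theorem ChainIn.isChain {P : Type*} [PartialOrder P] {S : Set P} {l : List P}
    (h : ChainIn S l) : ∀ x ∈ l, ∀ y ∈ l, x ≤ y ∨ y ≤ x := by
  have : Std.Symm fun x y : P => x ≤ y ∨ y ≤ x := ⟨fun _ _ => Or.symm⟩
  exact fun x hx y hy => List.Pairwise.forall_of_forall (R := fun x y : P => x ≤ y ∨ y ≤ x)
    (fun x _ => Or.inl le_rfl) (h.pairwise.imp fun hxy => Or.inl hxy.le) hx hy

/-- A finite part of the binary tree of any height can be mapped into the binary tree of height `ω`,
preserving the order and incomparability. -/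
theorem BinNode.exists_collapse [Nonempty I] (D : Finset (BinNode I)) :
    ∃ g : BinNode I → BinNode ℕ, (∀ η ν, η ≤ ν → g η ≤ g ν) ∧
      ∀ η ∈ D, ∀ ν ∈ D, Incomp η ν → Incomp (g η) (g ν) := by
  classical
  choose! s hs using fun (p : BinNode I × BinNode I) (h : Incomp p.1 p.2) => Incomp.exists_ne h
  -- `E` contains, for each incomparable pair from `D`, one position where the two sequences differ.
  -- The map `g` keeps only the entries at positions in `E`, renumbered by their rank `rk`.
  let E : Finset I := (D ×ˢ D).image s
  let rk : I → ℕ := fun i => (E.filter (· < i)).card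
  have hmono : Monotone rk := fun i j hij =>
    Finset.card_le_card fun x hx => by
      rw [Finset.mem_filter] at hx ⊢
      exact ⟨hx.1, hx.2.trans_le hij⟩
  have hstrict : ∀ i ∈ E, ∀ j, i < j → rk i < rk j := fun i hi j hij =>
    Finset.card_lt_card ⟨fun x hx => by
      rw [Finset.mem_filter] at hx ⊢
      exact ⟨hx.1, hx.2.trans hij⟩, fun hsub =>
      lt_irrefl i (Finset.mem_filter.1 (hsub (Finset.mem_filter.2 ⟨hi, hij⟩))).2⟩
  have hinj : ∀ i ∈ E, ∀ j ∈ E, rk i = rk j → i = j := by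
    intro i hi j hj hij
    rcases lt_trichotomy i j with h | h | h
    · exact absurd hij (hstrict i hi j h).ne
    · exact h
    · exact absurd hij (hstrict j hj i h).ne'
  have hlt : ∀ {i j}, rk i < rk j → i < j := fun {i j} h =>
    lt_of_not_ge fun hji => absurd (hmono hji) (not_le.2 h)
  let g : BinNode I → BinNode ℕ := fun η =>
    ⟨rk η.len, fun k => decide (∃ i ∈ E, ∃ h : i < η.len, rk i = k.1 ∧ η.val ⟨i, h⟩ = true)⟩
  refine ⟨g, fun η ν h => ⟨hmono h.1, fun k => ?_⟩, fun η hη ν hν hi => ?_⟩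
  · refine decide_eq_decide.2 (exists_congr fun i => and_congr_right fun _ => ?_)
    constructor
    · rintro ⟨h₁, h₂, h₃⟩
      have h₄ : i < η.len := hlt (h₂ ▸ k.2)
      exact ⟨h₄, h₂, (h.2 ⟨i, h₄⟩).symm.trans h₃⟩
    · rintro ⟨h₁, h₂, h₃⟩
      exact ⟨h₁.trans_le h.1, h₂, (h.2 ⟨i, h₁⟩).trans h₃⟩
  · obtain ⟨h₁, h₂, hne⟩ := hs (η, ν) hi
    have hE : s (η, ν) ∈ E := Finset.mem_image_of_mem s (Finset.mk_mem_product hη hν)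
    have hval : ∀ (θ : BinNode I) (h : s (η, ν) < θ.len),
        (g θ).val ⟨rk (s (η, ν)), hstrict _ hE _ h⟩ = θ.val ⟨s (η, ν), h⟩ := by
      intro θ h
      rw [Bool.eq_iff_iff]
      refine decide_eq_true_iff.trans ⟨?_, fun hv => ⟨_, hE, h, rfl, hv⟩⟩
      rintro ⟨i, hiE, h', hrk, hv⟩
      obtain rfl := hinj i hiE _ hE hrk
      exact hv
    refine incomp_of_ne (hstrict _ hE _ h₁) (hstrict _ hE _ h₂) ?_
    rw [hval η h₁, hval ν h₂]
    exact hne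

/-- The list of the entries of a finite `0-1` sequence. -/
def BinNode.toList (η : BinNode ℕ) : List Bool := List.ofFn fun i : Fin η.len => η.val ⟨i, i.2⟩

theorem BinNode.length_toList (η : BinNode ℕ) : η.toList.length = η.len := by simp [toList]

theorem BinNode.toList_prefix_iff {η ν : BinNode ℕ} : η.toList <+: ν.toList ↔ η ≤ ν := by
  rw [List.prefix_iff_getElem]
  simp only [length_toList]
  refine exists_congr fun h => ?_
  simp only [toList, List.getElem_ofFn]
  exact ⟨fun H i => (H i.1 i.2).symm, fun H i hi => (H ⟨i, hi⟩).symm⟩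

end BinaryTree

/-! ### The two implications. -/

section Main

open FirstOrder FirstOrder.Language

variable {L : FirstOrder.Language.{u, v}} {α β : Type} {T : L.Theory}

theorem isChain_restrict {I : Type w} [LinearOrder I] (η : I → Bool) (F : Set (BinNode I))
    (hF : ∀ x ∈ F, ∃ i, x = BinNode.restrict η i) : IsChain (· ≤ ·) F := by
  intro x hx y hy _
  obtain ⟨i, rfl⟩ := hF x hx
  obtain ⟨j, rfl⟩ := hF y hy
  exact (le_total i j).imp (BinNode.restrict_le_restrict η) (BinNode.restrict_le_restrict η)

/-- If the instances at the finite chains have common solutions, then the instances at the nodes of a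
branch are consistent. -/
theorem consistent_of_branch {I : Type w} [LinearOrder I] {M : Type*} [L.Structure M]
    {φ : L.Formula (α ⊕ β)} {a : BinNode I → β → M}
    (ha : ∀ F : Finset (BinNode I), IsChain (· ≤ ·) (F : Set (BinNode I)) →
      ∃ x : α → M, ∀ η ∈ F, φ.Realize (Sum.elim x (a η)))
    (η : I → Bool) {B : Set (β → M)} (hB : ∀ b ∈ B, ∃ i, b = a (BinNode.restrict η i)) :
    Consistent φ B := by
  classical
  intro F hF
  have : ∀ b : F, ∃ i, b.1 = a (BinNode.restrict η i) := fun b => hB b.1 (hF b.2)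
  choose i hi using this
  obtain ⟨x, hx⟩ := ha (Finset.univ.image fun b : F => BinNode.restrict η (i b))
    (isChain_restrict η _ (by
      intro y hy
      obtain ⟨b, -, rfl⟩ := Finset.mem_image.1 (Finset.mem_coe.1 hy)
      exact ⟨i b, rfl⟩))
  refine ⟨x, fun b hb => ?_⟩
  rw [show b = a (BinNode.restrict η (i ⟨b, hb⟩)) from hi ⟨b, hb⟩]
  exact hx _ (Finset.mem_image_of_mem _ (Finset.mem_univ _))

theorem RealizesTree.exemplifiesSOPTwo {φ : L.Formula (α ⊕ β)}
    (h : RealizesTree.{u, v, max u v} T φ (Set.univ : Set (BinNode ℕ))) :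
    ExemplifiesSOPTwo T φ := by
  classical
  obtain ⟨M, a, ha₁, ha₂⟩ := h
  refine ⟨M, a, fun η => ?_, fun η ν hi hc => ?_⟩
  · refine consistent_of_branch (fun F hF => ha₁ F (Set.subset_univ _) hF) η ?_
    rintro b ⟨i, rfl⟩
    exact ⟨i, rfl⟩
  · obtain ⟨x, hx⟩ := hc {a η, a ν} (by simp)
    exact ha₂ η trivial ν trivial hi ⟨x, hx _ (by simp), hx _ (by simp)⟩

theorem ExemplifiesSOPTwo.realizesTree {I : Type w} [LinearOrder I] [Nonempty I]
    {φ : L.Formula (α ⊕ β)} (h : ExemplifiesSOPTwo T φ) (D : Finset (BinNode I)) :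
    RealizesTree.{u, v, max u v} T φ (D : Set (BinNode I)) := by
  classical
  obtain ⟨M, a, ha₁, ha₂⟩ := h
  obtain ⟨g, hg₁, hg₂⟩ := BinNode.exists_collapse D
  refine ⟨M, fun η => a (g η), fun F _ hF => ?_, fun η hη ν hν hi => ?_⟩
  · have hF' : IsChain (· ≤ ·) ((F.image g : Finset (BinNode ℕ)) : Set (BinNode ℕ)) := by
      rw [Finset.coe_image]
      rintro _ ⟨x, hx, rfl⟩ _ ⟨y, hy, rfl⟩ _
      exact (hF.total hx hy).imp (hg₁ x y) (hg₁ y x)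
    obtain ⟨η, hη⟩ := BinNode.exists_branch hF'
    obtain ⟨x, hx⟩ := ha₁ η (F.image fun ν => a (g ν)) (by
      intro b hb
      obtain ⟨ν, hν, rfl⟩ := Finset.mem_image.1 (Finset.mem_coe.1 hb)
      exact ⟨(g ν).len, congrArg a (hη _ (Finset.mem_image_of_mem g hν)).symm⟩)
    exact ⟨x, fun ν hν => hx _ (Finset.mem_image_of_mem _ hν)⟩
  · rintro ⟨x, hx₁, hx₂⟩
    refine ha₂ _ _ (BinNode.incomparable_iff.2 (hg₂ η hη ν hν hi)) fun F hF => ⟨x, fun b hb => ?_⟩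
    rcases hF hb with rfl | rfl
    exacts [hx₁, hx₂]

theorem ExemplifiesSOPTwo.primePrime [Finite α] (I : Type w) [LinearOrder I] [Nonempty I]
    {φ : L.Formula (α ⊕ β)} (h : ExemplifiesSOPTwo T φ) :
    ExemplifiesSOPTwoPrimePrime T I φ := by
  obtain ⟨M, a, ha₁, ha₂⟩ := RealizesTree.univ_of_finite.{u, v, w, max u v}
    fun D : Finset (BinNode I) => h.realizesTree D
  -- With `n = 1`, the sequences of length one are mapped to pairwise incomparable nodes; `m ≥ 2`
  -- provides two of them.
  refine ⟨M, 1, fun c => a (c 1), fun η => ?_, 2, fun m hm f hf hc => ?_⟩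
  · refine consistent_of_branch (fun F hF => ha₁ F (Set.subset_univ _) hF) η ?_
    rintro b ⟨c, -, -, rfl⟩
    exact ⟨c 1, rfl⟩
  · classical
    let s : Fin m → FinNode m 1 := fun i => ⟨[i], le_rfl⟩
    have hs : ∀ i, (s i).restrict 1 = s i := fun i => rfl
    let i₀ : Fin m := ⟨0, by omega⟩
    let i₁ : Fin m := ⟨1, by omega⟩
    have hne : i₀ ≠ i₁ := by simp [i₀, i₁]
    have hi : Incomp (f (s i₀)) (f (s i₁)) := BinNode.incomparable_iff.1
      (hf.map_incomparable _ _ (by simpa [s] using hne) (by simpa [s] using hne.symm))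
    obtain ⟨x, hx⟩ := hc {a (f (s i₀)), a (f (s i₁))} (by
      intro b hb
      rcases Finset.mem_insert.1 (Finset.mem_coe.1 hb) with rfl | hb
      · exact ⟨s i₀, rfl, rfl⟩
      · rw [Finset.mem_singleton.1 hb]
        exact ⟨s i₁, rfl, rfl⟩)
    exact ha₂ _ trivial _ trivial hi ⟨x, hx _ (by simp), hx _ (by simp)⟩

/-- The instances of `φ` at the strictly increasing `(n + 1)`-tuples of elements of `l` have a common
solution. -/
def ConOn {M P : Type*} [L.Structure M] [PartialOrder P] (φ : L.Formula (α ⊕ β)) {n : ℕ}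
    (a : (Fin (n + 1) → P) → β → M) (l : List P) : Prop :=
  ∃ x : α → M, ∀ c : Fin (n + 1) → P, StrictMono c → (∀ i, c i ∈ l) →
    φ.Realize (Sum.elim x (a c))

theorem ConOn.of_subset {M P : Type*} [L.Structure M] [PartialOrder P] {φ : L.Formula (α ⊕ β)}
    {n : ℕ} {a : (Fin (n + 1) → P) → β → M} {l l' : List P} (hl : l ⊆ l') (h : ConOn φ a l') :
    ConOn φ a l := by
  obtain ⟨x, hx⟩ := h
  exact ⟨x, fun c hc hm => hx c hc fun i => hl (hm i)⟩

/-- The instances of `φ` at the strictly increasing tuples of elements of a list can be arranged as a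
single instance of a power of `φ`. -/
theorem exists_conjPower_instance {M P : Type*} [L.Structure M] [PartialOrder P]
    (φ : L.Formula (α ⊕ β)) {n : ℕ} (a : (Fin (n + 1) → P) → β → M) {N : ℕ} (l : List P)
    (hl : l.length = N) (hd : ∃ d : Fin (n + 1) → P, StrictMono d ∧ ∀ i, d i ∈ l) :
    ∃ b : Fin (Fintype.card (Fin (n + 1) → Fin N)) × β → M, ∀ x : α → M,
      (conjPower φ _).Realize (Sum.elim x b) ↔
        ∀ c : Fin (n + 1) → P, StrictMono c → (∀ i, c i ∈ l) →
          φ.Realize (Sum.elim x (a c)) := by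
  classical
  obtain ⟨d, hd, hdl⟩ := hd
  subst hl
  let tup : (Fin (n + 1) → Fin l.length) → Fin (n + 1) → P := fun j i => l.get (j i)
  let inst : (Fin (n + 1) → Fin l.length) → β → M := fun j =>
    -- Tuples of positions that do not give an increasing tuple are filled with the instance at the
    -- increasing tuple `d`, which is required anyway. Thus the number of conjuncts depends only on
    -- `N` and `n`.
    if StrictMono (tup j) then a (tup j) else a d
  let e := Fintype.equivFin (Fin (n + 1) → Fin l.length)
  refine ⟨fun p => inst (e.symm p.1) p.2, fun x => ?_⟩
  rw [realize_conjPower]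
  constructor
  · intro h c hc hcl
    choose j hj using fun i => List.get_of_mem (hcl i)
    have htup : tup j = c := funext hj
    have := h (e j)
    simp only [Equiv.symm_apply_apply] at this
    have hinst : inst j = a c := by
      simp only [inst, htup, if_pos hc]
    rw [← hinst]
    exact this
  · intro h i
    by_cases hs : StrictMono (tup (e.symm i))
    · simp only [inst, if_pos hs]
      exact h _ hs fun j => List.get_mem _ _
    · simp only [inst, if_neg hs]
      exact h d hd hdl

/-- Start from the empty list and the single tree of all successor nodes. Splittability would put a
copy of ${}^{n\ge}m$ into a consistent list, and the instances along its branches would have a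
common solution, against (b). -/
theorem not_splittable_conOn {I : Type w} [LinearOrder I] [WellFoundedLT I] [NoMaxOrder I]
    [Nonempty I] {M : Type*} [L.Structure M] {φ : L.Formula (α ⊕ β)} {n m : ℕ}
    {a : (Fin (n + 1) → BinNode I) → β → M}
    (hchain : ∀ l, ChainIn {x : BinNode I | x.HasSuccLength} l → ConOn φ a l)
    (hm : ∀ h : FinNode m n → BinNode I, IsTreeEmbedding h →
      ¬ Consistent φ {b | ∃ s : FinNode m n, s.1.length = n ∧
          b = a (fun l : Fin (n + 1) => h (s.restrict l))}) :
    ¬ Splittable (ConOn φ a) := by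
  intro hsp
  obtain ⟨s', h'⟩ := hsp.extendableBy_hasBlob (fun _ _ => ConOn.of_subset) m n 0 0
  obtain ⟨H, hH⟩ := h' 0
  obtain ⟨u, -, -, F, hF, hblob, hFu, S', Ss', -, -, hc⟩ := hH [] rfl
    {x : BinNode I | x.HasSuccLength} [] rfl
    (by simpa using BinNode.tall_hasSuccLength H) (fun l hl _ => hchain l hl)
  obtain ⟨f, hfF, hflt, hfinc⟩ := hblob.exists_map
  have hemb : IsTreeEmbedding fun s : FinNode m n => f s.1 := by
    refine ⟨fun s t hst => ?_, fun s t hst hne => ?_, fun s t h₁ h₂ => ?_,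
      fun s => hF (hfF s.1 s.2)⟩
    · by_contra hne
      have hne' : s.1 ≠ t.1 := fun h => hne (Subtype.ext h)
      by_cases h₁ : s.1 <+: t.1
      · exact (hflt _ _ s.2 t.2 h₁ hne').ne hst
      by_cases h₂ : t.1 <+: s.1
      · exact (hflt _ _ t.2 s.2 h₂ hne'.symm).ne hst.symm
      exact (hfinc _ _ s.2 t.2 h₁ h₂).1 (le_of_eq hst)
    · exact BinNode.isProperInitial_iff.2
        (hflt _ _ s.2 t.2 hst fun h => hne (Subtype.ext h))
    · exact BinNode.incomparable_iff.2 (hfinc _ _ s.2 t.2 h₁ h₂)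
  obtain ⟨x, hx⟩ := hc.con
  refine hm _ hemb fun G hG => ⟨x, fun b hb => ?_⟩
  obtain ⟨s, hs, rfl⟩ := hG hb
  refine hx _ (fun i j hij => ?_) fun i => hFu _ (hfF _ (s.restrict i).2)
  refine hflt _ _ (s.restrict i).2 (s.restrict j).2 (List.take_prefix_take_left hij.le) fun he => ?_
  have hlen := congrArg List.length he
  have h₁ : (i : ℕ) < j := hij
  have h₂ : (j : ℕ) < n + 1 := j.2
  simp only [FinNode.restrict, List.length_take, hs] at hlen
  omega

/-- A finite chain lies on one branch and has only finitely many increasing tuples, so a finite part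
of (a) suffices. -/
theorem conOn_of_chainIn {I : Type w} [LinearOrder I] {M : Type*} [L.Structure M]
    {φ : L.Formula (α ⊕ β)} {n : ℕ} {a : (Fin (n + 1) → BinNode I) → β → M}
    (ha : ∀ η : I → Bool, Consistent φ
      {b | ∃ c : Fin (n + 1) → I, StrictMono c ∧
        (∀ l, (BinNode.restrict η (c l)).HasSuccLength) ∧
        b = a (fun l => BinNode.restrict η (c l))})
    {l : List (BinNode I)} (hl : ChainIn {x : BinNode I | x.HasSuccLength} l) :
    ConOn φ a l := by
  classical
  obtain ⟨η, hη⟩ := BinNode.exists_branch (F := l.toFinset) (by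
    intro x hx y hy _
    exact hl.isChain x (by simpa using hx) y (by simpa using hy))
  have hfin : {b | ∃ c : Fin (n + 1) → BinNode I, (StrictMono c ∧ ∀ i, c i ∈ l) ∧
      a c = b}.Finite := by
    refine Set.Finite.image a (Set.Finite.subset
      (Set.Finite.pi' fun _ : Fin (n + 1) => l.toFinset.finite_toSet) ?_)
    rintro c ⟨-, hc⟩ i
    simpa using hc i
  obtain ⟨x, hx⟩ := ha η hfin.toFinset (by
    intro b hb
    rw [Set.Finite.coe_toFinset] at hb
    obtain ⟨c, ⟨hc, hcl⟩, rfl⟩ := hb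
    have hcη : ∀ i, BinNode.restrict η (c i).len = c i := fun i =>
      (hη _ (by simpa using hcl i)).symm
    refine ⟨fun i => (c i).len, fun i j hij => BinNode.len_lt_of_lt (hc hij), fun i => ?_, ?_⟩
    · rw [hcη i]
      exact hl.mem _ (hcl i)
    · simp only [hcη])
  exact ⟨x, fun c hc hcl => hx _ (hfin.mem_toFinset.2 ⟨c, ⟨hc, hcl⟩, rfl⟩)⟩

/-- The node `η` receives the instances at all increasing tuples from `u ++ c η.toList`. This list
has length `s + h` whatever the height of the tree of chains, so one power of the formula serves all
finite parts of the tree. -/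
theorem ExemplifiesSOPTwoPrimePrime.exists_conjPower [Finite α] {I : Type w} [LinearOrder I]
    [WellFoundedLT I] [NoMaxOrder I] [Nonempty I] {φ : L.Formula (α ⊕ β)}
    (hφ : ExemplifiesSOPTwoPrimePrime T I φ) : ∃ k, ExemplifiesSOPTwo T (conjPower φ k) := by
  classical
  obtain ⟨M, n, a, ha, m, hm⟩ := hφ
  -- Chains of length at least `n + 1` ensure that each list contains an increasing tuple, as
  -- `exists_conjPower_instance` requires.
  obtain ⟨s, h, hnh, htree⟩ := exists_chainTree_of_not_splittable
    (fun _ _ => ConOn.of_subset)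
    (not_splittable_conOn (fun l hl => conOn_of_chainIn ha hl) (hm m le_rfl)) (n + 1)
  refine ⟨Fintype.card (Fin (n + 1) → Fin (s + h)), RealizesTree.exemplifiesSOPTwo
    (RealizesTree.univ_of_finite.{u, v, 0, max u v w} fun D => ?_)⟩
  let t : ℕ := D.sup (fun η => η.len) + 1
  have ht : ∀ η ∈ D, η.toList.length < t := fun η hη => by
    rw [BinNode.length_toList]
    exact Nat.lt_succ_of_le (Finset.le_sup (f := fun η : BinNode ℕ => η.len) hη)
  obtain ⟨u, S, c, hu, hc, hcon, hinc⟩ := htree t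
  have hinst : ∀ η : BinNode ℕ, η ∈ D →
      ∃ b : Fin (Fintype.card (Fin (n + 1) → Fin (s + h))) × β → M, ∀ x : α → M,
      (conjPower φ _).Realize (Sum.elim x b) ↔
        ∀ d : Fin (n + 1) → BinNode I, StrictMono d → (∀ i, d i ∈ u ++ c η.toList) →
          φ.Realize (Sum.elim x (a d)) := by
    intro η hη
    have hlen := hc.length_eq _ (ht η hη)
    refine exists_conjPower_instance φ a _ (by simp [hu, hlen]) ?_
    refine ⟨fun i => (c η.toList).get (Fin.cast hlen.symm (Fin.castLE hnh i)), ?_, fun i =>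
      List.mem_append_right _ (List.get_mem _ _)⟩
    intro i j hij
    exact List.pairwise_iff_get.1 (hc.chainIn _ (ht η hη)).pairwise _ _ hij
  have hM : Nonempty (Fin (Fintype.card (Fin (n + 1) → Fin (s + h))) × β → M) :=
    ⟨fun _ => Classical.arbitrary M⟩
  choose! b hb using hinst
  refine ⟨M, b, fun F hFD hF => ?_, fun η hη ν hν hi => ?_⟩
  · rcases F.eq_empty_or_nonempty with rfl | hne
    · exact ⟨fun _ => Classical.arbitrary M, by simp⟩
    obtain ⟨τ, hτ, hmax⟩ := exists_greatest_of_isChain hF hne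
    obtain ⟨l, hl, hsub⟩ := hc.exists_chainIn τ.toList (ht τ (hFD hτ))
    obtain ⟨x, hx⟩ := hcon l hl
    refine ⟨x, fun η hη => (hb η (hFD hη) x).2 fun d hd hdl => hx d hd fun i => ?_⟩
    exact List.append_subset.2 ⟨List.subset_append_left _ _, fun _ hy => List.mem_append_right _
      (hsub _ (BinNode.toList_prefix_iff.2 (hmax η hη)) hy)⟩ (hdl i)
  · rintro ⟨x, hx₁, hx₂⟩
    have h₁ : ¬ η.toList <+: ν.toList := fun h => hi.1 (BinNode.toList_prefix_iff.1 h)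
    have h₂ : ¬ ν.toList <+: η.toList := fun h => hi.2 (BinNode.toList_prefix_iff.1 h)
    refine hinc _ _ (ht η hη) (ht ν hν) h₁ h₂ ⟨x, fun d hd hdl => ?_⟩
    simp only [List.mem_append] at hdl
    -- An increasing tuple cannot meet both of two incomparable chains, so it lies in `u` together
    -- with just one of them and is covered by one of the two instances. Hence a common solution
    -- would make the union of the lists consistent.
    by_cases hex : ∃ i, d i ∈ c η.toList
    · obtain ⟨i, hdi⟩ := hex
      refine (hb η hη x).1 hx₁ d hd fun j => List.mem_append.2 ((hdl j).resolve_right fun hj => ?_)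
      have hinc := hc.incomp _ _ (ht η hη) (ht ν hν) h₁ h₂ _ hdi _ hj
      exact (le_total i j).elim (fun hij => hinc.1 (hd.monotone hij))
        fun hji => hinc.2 (hd.monotone hji)
    · refine (hb ν hν x).1 hx₂ d hd fun j => List.mem_append.2 ?_
      exact (hdl j).imp (fun h => h.resolve_right fun hj => hex ⟨j, hj⟩) id

/-- Serves to re-index the parameter variables `Fin k × Fin q` of a power of the formula by `Fin (k
* q)`, as `HasSOPTwo` requires. -/
theorem ExemplifiesSOPTwo.relabel {β' : Type} {φ : L.Formula (α ⊕ β)} (e : β ≃ β')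
    (h : ExemplifiesSOPTwo T φ) :
    ExemplifiesSOPTwo T (φ.relabel (Sum.map id e) : L.Formula (α ⊕ β')) := by
  classical
  obtain ⟨M, a, ha₁, ha₂⟩ := h
  have hreal : ∀ (x : α → M) (b : β' → M), (φ.relabel (Sum.map id e)).Realize (Sum.elim x b) ↔
      φ.Realize (Sum.elim x (b ∘ e)) := by
    intro x b
    rw [Formula.realize_relabel, Sum.elim_comp_map, Function.comp_id]
  refine ⟨M, fun η => a η ∘ e.symm, fun η F hF => ?_, fun η ν hi hc => ha₂ η ν hi fun F hF => ?_⟩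
  · obtain ⟨x, hx⟩ := ha₁ η (F.image (· ∘ e)) (by
      intro b hb
      obtain ⟨b, hbF, rfl⟩ := Finset.mem_image.1 (Finset.mem_coe.1 hb)
      obtain ⟨l, rfl⟩ := hF hbF
      exact ⟨l, by ext; simp⟩)
    exact ⟨x, fun b hb => (hreal x b).2 (hx _ (Finset.mem_image_of_mem _ hb))⟩
  · obtain ⟨x, hx⟩ := hc (F.image (· ∘ e.symm)) (by
      intro b hb
      obtain ⟨b, hbF, rfl⟩ := Finset.mem_image.1 (Finset.mem_coe.1 hb)
      rcases hF hbF with rfl | rfl <;> simp)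
    refine ⟨x, fun b hb => ?_⟩
    have := (hreal x _).1 (hx _ (Finset.mem_image_of_mem _ hb))
    rwa [Function.comp_assoc, Equiv.symm_comp_self, Function.comp_id] at this

end Main

end OrderTree

theorem mainTheorem3 {L : FirstOrder.Language.{u, v}} (T : L.Theory)
    (I : Type w) [LinearOrder I] [WellFoundedLT I] [NoMaxOrder I] [Nonempty I] :
    (∀ (p q : ℕ) (θ : L.Formula (Fin p ⊕ Fin q)),
      OrderTree.ExemplifiesSOPTwo T θ → OrderTree.ExemplifiesSOPTwoPrimePrime T I θ) ∧
    (∀ (p q : ℕ) (θ : L.Formula (Fin p ⊕ Fin q)),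
      OrderTree.ExemplifiesSOPTwoPrimePrime T I θ →
        ∃ k : ℕ, OrderTree.ExemplifiesSOPTwo T (OrderTree.conjPower θ k)) ∧
    (OrderTree.HasSOPTwo T ↔ OrderTree.HasSOPTwoPrimePrime T I) := by
  refine ⟨fun p q θ h => h.primePrime I, fun p q θ h => h.exists_conjPower, ?_, ?_⟩
  · rintro ⟨p, q, θ, h⟩
    exact ⟨p, q, θ, h.primePrime I⟩
  · rintro ⟨p, q, θ, h⟩
    obtain ⟨k, hk⟩ := h.exists_conjPower
    exact ⟨p, k * q, _, hk.relabel finProdFinEquiv⟩
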